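/- For each $i\in\mathbb N$ let $G_i$ be the symmetric group $S_{n_i}$ or the alternating group $A_{n_i}$, acting primitively (in particular transitively) on a finite set $\Omega_i$ with $|\Omega_i|\ge 3$, and assume that $n_i\to\infty$. For $w\in G_i$ let $F_i(w)$ be the number of fixed points of $w$ on $\Omega_i$, let $d_i$ be the proportion of $w\in G_i$ with $F_i(w)=0$, and let the rank of $G_i$ on $\Omega_i$ be the number of orbits of $G_i$ on $\Omega_i\times\Omega_i$. Then the following are equivalent: 1. $\lim_{i\to\infty} d_i=1$; 2. there is no fixed $k$ such that, for infinitely many $i$, $\Omega_i$ is isomorphic as a $G_i$-set to the set of $k$-element subsets of $\{1,\dots,n_i\}$ with its natural action; 3. the rank of $G_i$ acting on $\Omega_i$ tends to $\infty$. Consequently, the only actions with a nontrivial limit law are those on $k$-sets with $k$ fixed: if, for $w\in G_i$ uniformly random, $F_i(w)$ converges in distribution as $i\to\infty$ to a probability law on $\{0,1,2,\dots\}$ other than the point mass at $0$, then there is a fixed $k$ such that for all sufficiently large $i$ the $G_i$-set $\Omega_i$ is isomorphic to the set of $k$-element subsets of $\{1,\dots,n_i\}$. -/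

import Mathlib

open Filter Topology

/-- The proportion of elements of `G` that fix exactly `j` points of `Ω`, i.e. the probability
that a uniformly random element of the finite group `G` has exactly `j` fixed points. -/
noncomputable def fixedPointLaw (G Ω : Type*) [Group G] [MulAction G Ω] (j : ℕ) : ℝ :=
  (Nat.card {w : G // Nat.card (MulAction.fixedBy Ω w) = j} : ℝ) / (Nat.card G : ℝ)

/-- The proportion of elements of `G` that have no fixed point on `Ω`. -/
noncomputable def derangementProportion (G Ω : Type*) [Group G] [MulAction G Ω] : ℝ :=
  (Nat.card {w : G // ∀ x : Ω, w • x ≠ x} : ℝ) / (Nat.card G : ℝ)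

/-- The rank of an action: the number of orbits of `G` on `Ω × Ω` for the diagonal action. -/
noncomputable def actionRank (G Ω : Type*) [Group G] [MulAction G Ω] : ℕ :=
  Nat.card (MulAction.orbitRel.Quotient G (Ω × Ω))

/-- `Ω` is, as a `G`-set, the set of `k`-element subsets of the `n` points on which the
permutation group `G` of degree `n` naturally acts. -/
def IsKSetAction {n : ℕ} (G : Subgroup (Equiv.Perm (Fin n))) (Ω : Type*) [MulAction G Ω]
    (k : ℕ) : Prop :=
  ∃ e : Ω →[G] Set.powersetCard (Fin n) k, Function.Bijective e

/-!
An element with a fixed point lies in a point stabilizer, a maximal subgroup `K` of `G` not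
containing the alternating group. If `K` is intransitive on the `n` points, it is the stabilizer of
an orbit and `Ω` consists of `k`-sets. If `K` is transitive, use that most permutations have a power
that is a `p`-cycle for some large prime `p ≤ n / 2`: the number of cycles of prime length
concentrates by Chebyshev's inequality, since the sum of `1 / p` over the primes diverges. By
Jordan's theorem such a `K` is not primitive, and the `p`-cycle fits into one of its blocks, so the
permutation preserves a large block. But a random permutation rarely preserves a set of size
`k ≤ n / 2` for large `k`: about `H_k` (the harmonic number) cycles of length at most `k` are
expected on the set and as many on its complement, which is twice the number for a typical
permutation. So derangements dominate unless `Ω` consists of `k`-sets with `k` bounded.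

The moments of the number of fixed points count orbits on powers of `Ω` by Burnside's lemma. With
derangement proportion `d`, the Cauchy-Schwarz inequality gives `1 ≤ (1 - d) * rank`, so the rank
tends to infinity when `d` tends to `1`; the rank on `k`-sets is `k + 1`. A limit law other than the
point mass at `0` bounds `k`, hence the third moments, so the ranks converge and determine `k`.
-/

open Equiv Function MulAction
open scoped BigOperators

section Proportion

variable {α β ι : Type*}

/-- The probability that a uniformly random element of the finite type `α` satisfies `P`; it is `0`
when `α` is empty. -/
noncomputable def proportion (P : α → Prop) : ℝ :=
  (Nat.card {x // P x} : ℝ) / Nat.card α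

theorem proportion_nonneg (P : α → Prop) : 0 ≤ proportion P := by
  unfold proportion
  positivity

theorem proportion_congr_equiv (e : α ≃ β) (P : β → Prop) :
    proportion (fun x => P (e x)) = proportion P := by
  rw [proportion, proportion, Nat.card_congr e,
    Nat.card_congr (e.subtypeEquiv (p := fun x => P (e x)) fun _ => Iff.rfl)]

section Fintype

variable [Fintype α]

theorem proportion_eq_expect (P : α → Prop) [DecidablePred P] :
    proportion P = 𝔼 x, if P x then (1 : ℝ) else 0 := by
  rw [proportion, Fintype.expect_eq_sum_div_card, Finset.sum_boole, Nat.card_eq_fintype_card,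
    Nat.card_eq_fintype_card, Fintype.card_subtype]

theorem proportion_mul_le_expect {P : α → Prop} {f : α → ℝ} (hf : ∀ x, 0 ≤ f x) {t : ℝ}
    (h : ∀ x, P x → t ≤ f x) :
    proportion P * t ≤ 𝔼 x, f x := by
  classical
  rw [proportion_eq_expect, Finset.expect_mul]
  refine Finset.expect_le_expect fun x _ => ?_
  split_ifs with hx
  · simpa using h x hx
  · simpa using hf x

theorem proportion_chebyshev {f : α → ℝ} {m t : ℝ} (ht : 0 ≤ t) :
    proportion (fun x => t ≤ |f x - m|) * t ^ 2 ≤ 𝔼 x, (f x - m) ^ 2 := by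
  refine proportion_mul_le_expect (fun x => sq_nonneg _) fun x hx => ?_
  rw [← sq_abs (f x - m)]
  exact pow_le_pow_left₀ ht hx 2

end Fintype

section Finite

variable [Finite α] {P Q R : α → Prop}

theorem proportion_mono (h : ∀ x, P x → Q x) : proportion P ≤ proportion Q := by
  classical
  have := Fintype.ofFinite α
  rw [proportion_eq_expect Q, ← mul_one (proportion P)]
  refine proportion_mul_le_expect (fun x => ?_) fun x hx => ?_
  · split_ifs <;> norm_num
  · rw [if_pos (h x hx)]

theorem proportion_exists_le (s : Finset ι) (P : ι → α → Prop) :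
    proportion (fun x => ∃ i ∈ s, P i x) ≤ ∑ i ∈ s, proportion (P i) := by
  classical
  have := Fintype.ofFinite α
  simp only [proportion_eq_expect, ← Finset.expect_sum_comm]
  refine Finset.expect_le_expect fun x _ => ?_
  have h0 : ∀ i ∈ s, (0 : ℝ) ≤ if P i x then 1 else 0 := fun i _ => by split_ifs <;> norm_num
  split_ifs with hx
  · obtain ⟨i, hi, hPi⟩ := hx
    simpa only [if_pos hPi] using Finset.single_le_sum h0 hi
  · exact Finset.sum_nonneg h0

theorem proportion_le_add (h : ∀ x, P x → Q x ∨ R x) :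
    proportion P ≤ proportion Q + proportion R := by
  classical
  have := Fintype.ofFinite α
  rw [proportion_eq_expect Q, proportion_eq_expect R, ← Finset.expect_add_distrib,
    ← mul_one (proportion P)]
  refine proportion_mul_le_expect (fun x => ?_) fun x hx => ?_
  · split_ifs <;> norm_num
  · rcases h x hx with hQ | hR
    · rw [if_pos hQ]
      split_ifs <;> norm_num
    · rw [if_pos hR]
      split_ifs <;> norm_num

theorem proportion_not [Nonempty α] (P : α → Prop) :
    proportion (fun x => ¬ P x) = 1 - proportion P := by
  classical
  have := Fintype.ofFinite α
  rw [eq_sub_iff_add_eq, proportion_eq_expect, proportion_eq_expect, ← Finset.expect_add_distrib]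
  refine (Finset.expect_congr rfl fun x _ => ?_).trans (Fintype.expect_const (1 : ℝ))
  split_ifs <;> norm_num

variable [Finite β]

theorem proportion_fst [Nonempty β] (P : α → Prop) :
    proportion (fun x : α × β => P x.1) = proportion P := by
  classical
  have := Fintype.ofFinite α
  have := Fintype.ofFinite β
  rw [proportion_eq_expect, proportion_eq_expect, ← Finset.univ_product_univ,
    Finset.expect_product]
  exact Finset.expect_congr rfl fun x _ =>
    Finset.expect_const Finset.univ_nonempty (if P x then (1 : ℝ) else 0)

theorem proportion_snd [Nonempty α] (P : β → Prop) :
    proportion (fun x : α × β => P x.2) = proportion P := by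
  rw [← proportion_fst (β := α) P]
  exact proportion_congr_equiv (Equiv.prodComm α β) fun x => P x.1

end Finite

end Proportion

theorem proportion_subgroup_le_index_mul {M : Type*} [Group M] [Finite M] (H : Subgroup M)
    (P : M → Prop) : proportion (fun h : H => P h) ≤ H.index * proportion P := by
  have hinj : Nat.card {h : H // P h} ≤ Nat.card {g : M // P g} :=
    Nat.card_le_card_of_injective (fun h => ⟨h.1.1, h.2⟩) fun h h' hh =>
      Subtype.ext (Subtype.ext (Subtype.mk.inj hh))
  have hH : (0 : ℝ) < Nat.card H := by exact_mod_cast Nat.card_pos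
  have hi : (0 : ℝ) < H.index := by exact_mod_cast Nat.pos_of_ne_zero H.index_ne_zero_of_finite
  rw [proportion, proportion, ← H.index_mul_card, Nat.cast_mul, div_le_iff₀ hH]
  calc (Nat.card {h : H // P h} : ℝ) ≤ Nat.card {g : M // P g} := by exact_mod_cast hinj
    _ = _ := by field_simp

section CycleStatistics

/-- The sum of the reciprocals of the elements of `L`, which is the expected number of cycles with
length in `L` of a random permutation; `reciprocalSum (Finset.Icc 1 n)` is the `n`-th harmonic
number. -/
noncomputable def reciprocalSum (L : Finset ℕ) : ℝ :=
  ∑ l ∈ L, (l : ℝ)⁻¹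

theorem reciprocalSum_Icc_one_eq_harmonic (n : ℕ) :
    reciprocalSum (Finset.Icc 1 n) = (harmonic n : ℝ) := by
  rw [harmonic_eq_sum_Icc]
  push_cast
  rfl

theorem reciprocalSum_Icc_one_pos {n : ℕ} (hn : 1 ≤ n) : 0 < reciprocalSum (Finset.Icc 1 n) :=
  Finset.sum_pos (fun _ hl => inv_pos.2 (Nat.cast_pos.2 (Finset.mem_Icc.1 hl).1))
    (Finset.nonempty_Icc.2 hn)

variable {α β : Type*}

theorem minimalPeriod_perm_pos [Finite α] (σ : Perm α) (x : α) : 0 < minimalPeriod σ x :=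
  minimalPeriod_pos_of_mem_periodicPts (σ.injective.mem_periodicPts x)

/-- The cycle of `x` under `σ`, as a copy of `Fin l` on which `σ` acts as `finRotate l`. -/
def iterateEmbedding (σ : Perm α) (x : α) {l : ℕ} (hl : minimalPeriod σ x = l) : Fin l ↪ α where
  toFun i := σ^[i] x
  inj' i j hij := Fin.ext <|
    iterate_injOn_Iio_minimalPeriod (i.2.trans_eq hl.symm) (j.2.trans_eq hl.symm) hij

theorem apply_iterateEmbedding [Finite α] (σ : Perm α) (x : α) {l : ℕ} (hl : minimalPeriod σ x = l)
    (i : Fin l) : σ (iterateEmbedding σ x hl i) = iterateEmbedding σ x hl (finRotate l i) := by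
  obtain ⟨k, rfl⟩ : ∃ k, l = k + 1 :=
    Nat.exists_eq_succ_of_ne_zero (hl ▸ (minimalPeriod_perm_pos σ x).ne')
  have hval : (finRotate (k + 1) i : ℕ) = (i + 1) % minimalPeriod σ x := by
    rw [finRotate_apply, Fin.val_add, Fin.val_one', Nat.add_mod_mod, hl]
  change σ (σ^[i] x) = σ^[(finRotate (k + 1) i : ℕ)] x
  rw [hval, iterate_mod_minimalPeriod_eq, iterate_succ_apply']

theorem minimalPeriod_eq_of_sameCycle {σ : Perm α} {x y : α} (h : σ.SameCycle x y) :
    minimalPeriod σ x = minimalPeriod σ y := by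
  obtain ⟨i, rfl⟩ := h
  refine minimalPeriod_eq_minimalPeriod_iff.2 fun n => ?_
  rw [IsPeriodicPt, IsPeriodicPt, IsFixedPt, IsFixedPt, Perm.iterate_eq_pow, ← Perm.mul_apply,
    (Commute.pow_left (Commute.self_zpow σ i) n).eq, Perm.mul_apply, (σ ^ i).injective.eq_iff]

theorem sameCycle_iff_exists_iterateEmbedding [Finite α] (σ : Perm α) (x y : α) :
    σ.SameCycle x y ↔ ∃ i, iterateEmbedding σ x rfl i = y := by
  constructor
  · intro h
    obtain ⟨i, hi⟩ := h.exists_nat_pow_eq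
    refine ⟨⟨i % minimalPeriod σ x, Nat.mod_lt _ (minimalPeriod_perm_pos σ x)⟩, ?_⟩
    change σ^[i % minimalPeriod σ x] x = y
    rw [iterate_mod_minimalPeriod_eq, Perm.iterate_eq_pow, hi]
  · rintro ⟨i, hi⟩
    exact ⟨i, by rw [zpow_natCast, ← Perm.iterate_eq_pow]; exact hi⟩

variable [Fintype α]

theorem minimalPeriod_mem_Icc_card (σ : Perm α) (x : α) :
    minimalPeriod σ x ∈ Finset.Icc 1 (Fintype.card α) :=
  Finset.mem_Icc.2 ⟨minimalPeriod_perm_pos σ x,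
    by simpa using Fintype.card_le_of_embedding (iterateEmbedding σ x rfl)⟩

theorem card_minimalPeriod_eq_le (σ : Perm α) (l : ℕ) :
    (Finset.univ.filter fun x => minimalPeriod σ x = l).card ≤
      Nat.card {f : Fin l ↪ α // ∀ b, σ (f b) = f (finRotate l b)} := by
  classical
  rw [← Fintype.card_subtype, Nat.card_eq_fintype_card]
  refine Fintype.card_le_of_injective
    (fun x => ⟨iterateEmbedding σ x.1 x.2, apply_iterateEmbedding σ x.1 x.2⟩) fun x y hxy => ?_
  have hl : 0 < l := x.2 ▸ minimalPeriod_perm_pos σ x.1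
  have hxy' := DFunLike.congr_fun (Subtype.ext_iff.1 hxy) ⟨0, hl⟩
  exact Subtype.ext hxy'

section DecidableEq

variable [DecidableEq α]

theorem card_perm_extending_le [Fintype β] (τ : Perm β) (f : β ↪ α) :
    Fintype.card {σ : Perm α // ∀ b, σ (f b) = f (τ b)} ≤
      (Fintype.card α - Fintype.card β).factorial := by
  classical
  let p : α → Prop := fun a => a ∉ Set.range f
  have hcard : Fintype.card (Subtype p) = Fintype.card α - Fintype.card β := by
    rw [Fintype.card_congr (Equiv.ofInjective f f.injective)]
    exact Fintype.card_subtype_compl (· ∈ Set.range f)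
  rw [← hcard, ← Fintype.card_perm, Fintype.card_congr (Perm.subtypeEquivSubtypePerm p)]
  refine Fintype.card_le_of_injective
    (fun σ => ⟨(τ.viaFintypeEmbedding f)⁻¹ * σ.1, ?_⟩) ?_
  · intro a ha
    obtain ⟨b, rfl⟩ : a ∈ Set.range f := not_not.1 ha
    rw [Perm.mul_apply, σ.2, ← Perm.viaFintypeEmbedding_apply_image]
    exact (τ.viaFintypeEmbedding f).symm_apply_apply _
  · intro σ σ' h
    exact Subtype.ext (mul_left_cancel (Subtype.ext_iff.1 h))

theorem expect_card_equivariant_embeddings_le_one [Finite β] (τ : Perm β) :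
    𝔼 σ : Perm α, (Nat.card {f : β ↪ α // ∀ b, σ (f b) = f (τ b)} : ℝ) ≤ 1 := by
  classical
  have := Fintype.ofFinite β
  have hswap : ∑ σ : Perm α, Nat.card {f : β ↪ α // ∀ b, σ (f b) = f (τ b)} =
      ∑ f : β ↪ α, Fintype.card {σ : Perm α // ∀ b, σ (f b) = f (τ b)} := by
    simp only [Nat.card_eq_fintype_card, Fintype.card_subtype, Finset.card_filter]
    exact Finset.sum_comm
  have hsum : ∑ σ : Perm α, Nat.card {f : β ↪ α // ∀ b, σ (f b) = f (τ b)} ≤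
      (Fintype.card α).factorial := by
    rw [hswap]
    refine (Finset.sum_le_sum fun f _ => card_perm_extending_le τ f).trans ?_
    rw [Finset.sum_const, Finset.card_univ, Fintype.card_embedding_eq, smul_eq_mul]
    rcases le_or_gt (Fintype.card β) (Fintype.card α) with h | h
    · rw [mul_comm, Nat.factorial_mul_descFactorial h]
    · rw [Nat.descFactorial_eq_zero_iff_lt.2 h, zero_mul]
      exact Nat.zero_le _
  rw [Fintype.expect_eq_sum_div_card, Fintype.card_perm, div_le_one (by positivity)]
  exact_mod_cast hsum

theorem expect_card_minimalPeriod_eq {l : ℕ} (hl : l ∈ Finset.Icc 1 (Fintype.card α)) :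
    𝔼 σ : Perm α, ((Finset.univ.filter fun x => minimalPeriod σ x = l).card : ℝ) = 1 := by
  have hle (l : ℕ) :
      𝔼 σ : Perm α, ((Finset.univ.filter fun x => minimalPeriod σ x = l).card : ℝ) ≤ 1 :=
    (Finset.expect_le_expect fun σ _ => by exact_mod_cast card_minimalPeriod_eq_le σ l).trans
      (expect_card_equivariant_embeddings_le_one (finRotate l))
  have htotal (σ : Perm α) : ∑ l ∈ Finset.Icc 1 (Fintype.card α),
      ((Finset.univ.filter fun x => minimalPeriod σ x = l).card : ℝ) = Fintype.card α := by
    have hmaps : ((Finset.univ : Finset α) : Set α).MapsTo (minimalPeriod σ)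
        (Finset.Icc 1 (Fintype.card α)) := fun x _ => minimalPeriod_mem_Icc_card σ x
    exact_mod_cast (Finset.card_eq_sum_card_fiberwise hmaps).symm
  refine (Finset.sum_eq_sum_iff_of_le fun l _ => hle l).1 ?_ l hl
  rw [← Finset.expect_sum_comm]
  simp only [htotal, Fintype.expect_const, Finset.sum_const, Nat.card_Icc, Nat.add_sub_cancel,
    nsmul_eq_mul, mul_one]

theorem card_pairs_minimalPeriod_eq_le (σ : Perm α) (l l' : ℕ) :
    (Finset.univ.filter fun x : α × α => ¬ σ.SameCycle x.1 x.2 ∧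
      (minimalPeriod σ x.1, minimalPeriod σ x.2) = (l, l')).card ≤
      Nat.card {f : Fin l ⊕ Fin l' ↪ α //
        ∀ b, σ (f b) = f (Equiv.sumCongr (finRotate l) (finRotate l') b)} := by
  have hcycle (x : α) (k : ℕ) : σ.SameCycle x (σ^[k] x) :=
    ⟨k, by rw [zpow_natCast, ← Perm.iterate_eq_pow]⟩
  rw [← Fintype.card_subtype, Nat.card_eq_fintype_card]
  refine Fintype.card_le_of_injective (fun x =>
    ⟨⟨Sum.elim (iterateEmbedding σ x.1.1 (Prod.mk.inj x.2.2).1)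
      (iterateEmbedding σ x.1.2 (Prod.mk.inj x.2.2).2),
      (Embedding.injective _).sumElim (Embedding.injective _) fun i j hij => ?_⟩, ?_⟩) ?_
  · have h := hcycle x.1.1 i
    rw [show σ^[i] x.1.1 = σ^[j] x.1.2 from hij] at h
    exact x.2.1 (h.trans (hcycle x.1.2 j).symm)
  · rintro (i | i)
    · exact apply_iterateEmbedding σ x.1.1 (Prod.mk.inj x.2.2).1 i
    · exact apply_iterateEmbedding σ x.1.2 (Prod.mk.inj x.2.2).2 i
  · intro x y hxy
    have hl : 0 < l := (Prod.mk.inj x.2.2).1 ▸ minimalPeriod_perm_pos σ x.1.1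
    have hl' : 0 < l' := (Prod.mk.inj x.2.2).2 ▸ minimalPeriod_perm_pos σ x.1.2
    have hfst := DFunLike.congr_fun (Subtype.ext_iff.1 hxy) (Sum.inl ⟨0, hl⟩)
    have hsnd := DFunLike.congr_fun (Subtype.ext_iff.1 hxy) (Sum.inr ⟨0, hl'⟩)
    exact Subtype.ext (Prod.ext hfst hsnd)

theorem card_sameCycle (σ : Perm α) (x : α) :
    (Finset.univ.filter fun y => σ.SameCycle x y).card = minimalPeriod σ x := by
  have : (Finset.univ.filter fun y => σ.SameCycle x y) =
      Finset.univ.map (iterateEmbedding σ x rfl) := by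
    ext y
    simp [sameCycle_iff_exists_iterateEmbedding]
  rw [this, Finset.card_map, Finset.card_univ, Fintype.card_fin]

/-- The sum of `W l l'` over the ordered pairs of distinct cycles of `σ`, fixed points included,
where `l` and `l'` are the lengths of the two cycles. -/
noncomputable def cyclePairSum (W : ℕ → ℕ → ℝ) (σ : Perm α) : ℝ :=
  ∑ x : α × α with ¬ σ.SameCycle x.1 x.2, W (minimalPeriod σ x.1) (minimalPeriod σ x.2) /
    (minimalPeriod σ x.1 * minimalPeriod σ x.2)

theorem expect_cyclePairSum_le {W : ℕ → ℕ → ℝ} (hW : ∀ l l', 0 ≤ W l l') :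
    𝔼 σ : Perm α, cyclePairSum W σ ≤ ∑ l ∈ Finset.Icc 1 (Fintype.card α),
      ∑ l' ∈ Finset.Icc 1 (Fintype.card α), W l l' / (l * l') := by
  set I := Finset.Icc 1 (Fintype.card α)
  have hfiber (σ : Perm α) : cyclePairSum W σ = ∑ p ∈ I ×ˢ I, W p.1 p.2 / (p.1 * p.2) *
      ((Finset.univ.filter fun x : α × α => ¬ σ.SameCycle x.1 x.2 ∧
        (minimalPeriod σ x.1, minimalPeriod σ x.2) = p).card : ℝ) := by
    rw [cyclePairSum, ← Finset.sum_fiberwise_of_maps_to' (t := I ×ˢ I)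
      (g := fun x : α × α => (minimalPeriod σ x.1, minimalPeriod σ x.2)) (fun x _ =>
        Finset.mk_mem_product (minimalPeriod_mem_Icc_card σ x.1) (minimalPeriod_mem_Icc_card σ x.2))
      fun p => W p.1 p.2 / (p.1 * p.2)]
    simp only [Finset.sum_const, Finset.filter_filter, nsmul_eq_mul, mul_comm]
  simp only [hfiber]
  rw [Finset.expect_sum_comm, ← Finset.sum_product']
  refine Finset.sum_le_sum fun p _ => ?_
  rw [← Finset.mul_expect]
  refine mul_le_of_le_one_right (div_nonneg (hW _ _) (by positivity)) ?_
  exact (Finset.expect_le_expect fun σ _ => by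
    exact_mod_cast card_pairs_minimalPeriod_eq_le σ p.1 p.2).trans
      (expect_card_equivariant_embeddings_le_one _)

theorem le_cyclePairSum {W : ℕ → ℕ → ℝ} (hW : ∀ l l', 0 ≤ W l l') {σ : Perm α} {x y : α}
    (hxy : ¬ σ.SameCycle x y) :
    W (minimalPeriod σ x) (minimalPeriod σ y) ≤ cyclePairSum W σ := by
  set s := (Finset.univ.filter fun z => σ.SameCycle x z) ×ˢ
    Finset.univ.filter fun z => σ.SameCycle y z with hs
  have hsub : s ⊆ Finset.univ.filter fun z : α × α => ¬ σ.SameCycle z.1 z.2 := by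
    intro z hz
    simp only [hs, Finset.mem_product, Finset.mem_filter, Finset.mem_univ, true_and] at hz ⊢
    exact fun h => hxy ((hz.1.trans h).trans hz.2.symm)
  have hterm : ∀ z ∈ s, W (minimalPeriod σ z.1) (minimalPeriod σ z.2) /
      (minimalPeriod σ z.1 * minimalPeriod σ z.2) =
      W (minimalPeriod σ x) (minimalPeriod σ y) / (minimalPeriod σ x * minimalPeriod σ y) := by
    intro z hz
    simp only [hs, Finset.mem_product, Finset.mem_filter, Finset.mem_univ, true_and] at hz
    rw [minimalPeriod_eq_of_sameCycle hz.1, minimalPeriod_eq_of_sameCycle hz.2]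
  have hpos (z : α) : (0 : ℝ) < minimalPeriod σ z := by exact_mod_cast minimalPeriod_perm_pos σ z
  calc W (minimalPeriod σ x) (minimalPeriod σ y)
      = ∑ z ∈ s, W (minimalPeriod σ z.1) (minimalPeriod σ z.2) /
          (minimalPeriod σ z.1 * minimalPeriod σ z.2) := by
        rw [Finset.sum_congr rfl hterm, Finset.sum_const, Finset.card_product, card_sameCycle,
          card_sameCycle, nsmul_eq_mul, Nat.cast_mul,
          mul_div_cancel₀ _ (mul_pos (hpos x) (hpos y)).ne']
    _ ≤ cyclePairSum W σ := Finset.sum_le_sum_of_subset_of_nonneg hsub fun z _ _ =>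
        div_nonneg (hW _ _) (by positivity)

/-- The number of cycles of `σ`, fixed points included, whose length belongs to `L`: the points of a
cycle of length `l` contribute `l⁻¹` each. -/
noncomputable def cycleCount (L : Finset ℕ) (σ : Perm α) : ℝ :=
  ∑ x with minimalPeriod σ x ∈ L, (minimalPeriod σ x : ℝ)⁻¹

theorem expect_cycleCount {L : Finset ℕ} (hL : L ⊆ Finset.Icc 1 (Fintype.card α)) :
    𝔼 σ : Perm α, cycleCount L σ = reciprocalSum L := by
  have hfiber (σ : Perm α) : cycleCount L σ = ∑ l ∈ L, (l : ℝ)⁻¹ *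
      ((Finset.univ.filter fun x => minimalPeriod σ x = l).card : ℝ) := by
    rw [cycleCount, ← Finset.sum_fiberwise_of_maps_to' (t := L) (g := minimalPeriod σ)
      (fun x hx => (Finset.mem_filter.1 hx).2) fun l => (l : ℝ)⁻¹]
    refine Finset.sum_congr rfl fun l hl => ?_
    rw [Finset.sum_const, Finset.filter_filter, nsmul_eq_mul, mul_comm]
    congr 4
    ext x
    exact ⟨And.right, fun h => ⟨h ▸ hl, h⟩⟩
  simp only [hfiber]
  rw [Finset.expect_sum_comm]
  refine Finset.sum_congr rfl fun l hl => ?_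
  rw [← Finset.mul_expect, expect_card_minimalPeriod_eq (hL hl), mul_one]

theorem cycleCount_sq (L : Finset ℕ) (σ : Perm α) :
    cycleCount L σ ^ 2 =
      cyclePairSum (fun l l' => if l ∈ L ∧ l' ∈ L then 1 else 0) σ + cycleCount L σ := by
  set u : α → ℝ := fun x => if minimalPeriod σ x ∈ L then (minimalPeriod σ x : ℝ)⁻¹ else 0 with hu
  have hcount : cycleCount L σ = ∑ x, u x := Finset.sum_filter _ _
  have hdistinct : cyclePairSum (fun l l' => if l ∈ L ∧ l' ∈ L then 1 else 0) σ =
      ∑ x : α × α with ¬ σ.SameCycle x.1 x.2, u x.1 * u x.2 := by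
    refine Finset.sum_congr rfl fun x _ => ?_
    by_cases h1 : minimalPeriod σ x.1 ∈ L <;> by_cases h2 : minimalPeriod σ x.2 ∈ L <;>
      simp [hu, h1, h2, mul_comm]
  have hsame : cycleCount L σ = ∑ x : α × α with σ.SameCycle x.1 x.2, u x.1 * u x.2 := by
    rw [hcount, Finset.sum_filter, Fintype.sum_prod_type]
    refine Finset.sum_congr rfl fun x _ => ?_
    have hconst : ∀ y ∈ Finset.univ.filter (fun y => σ.SameCycle x y), u x * u y = u x ^ 2 := by
      intro y hy
      simp only [hu, ← minimalPeriod_eq_of_sameCycle (Finset.mem_filter.1 hy).2, sq]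
    have hpos : (minimalPeriod σ x : ℝ) ≠ 0 := by exact_mod_cast (minimalPeriod_perm_pos σ x).ne'
    rw [← Finset.sum_filter, Finset.sum_congr rfl hconst, Finset.sum_const, card_sameCycle,
      nsmul_eq_mul]
    by_cases h : minimalPeriod σ x ∈ L
    · simp only [hu, if_pos h]
      field_simp
    · simp [hu, h]
  rw [hdistinct, hsame, add_comm, Finset.sum_filter_add_sum_filter_not, ← hsame, hcount, sq,
    Finset.sum_mul_sum, Fintype.sum_prod_type]

theorem expect_cycleCount_sub_sq_le {L : Finset ℕ} (hL : L ⊆ Finset.Icc 1 (Fintype.card α)) :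
    𝔼 σ : Perm α, (cycleCount L σ - reciprocalSum L) ^ 2 ≤ reciprocalSum L := by
  set h := reciprocalSum L with hh
  set W : ℕ → ℕ → ℝ := fun l l' => if l ∈ L ∧ l' ∈ L then 1 else 0 with hW
  have hpairs : 𝔼 σ : Perm α, cyclePairSum W σ ≤ h ^ 2 := by
    have hW0 (l l' : ℕ) : 0 ≤ W l l' := by
      simp only [hW]
      split_ifs <;> norm_num
    refine (expect_cyclePairSum_le hW0).trans_eq ?_
    rw [hh, sq, reciprocalSum, Finset.sum_mul_sum, ← Finset.sum_product', ← Finset.sum_product']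
    refine (Finset.sum_subset (Finset.product_subset_product hL hL) fun p _ hp => ?_).symm.trans
      (Finset.sum_congr rfl fun p hp => ?_)
    · simp only [hW, if_neg (Finset.mem_product.not.1 hp), zero_div]
    · simp only [hW, if_pos (Finset.mem_product.1 hp), one_div, mul_inv]
  have hexpand (σ : Perm α) :
      (cycleCount L σ - h) ^ 2 = cyclePairSum W σ + (1 - 2 * h) * cycleCount L σ + h ^ 2 := by
    rw [sub_sq, cycleCount_sq]
    ring
  have hmean : 𝔼 σ : Perm α, cycleCount L σ = h := expect_cycleCount hL
  simp only [hexpand]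
  rw [Finset.expect_add_distrib, Finset.expect_add_distrib, ← Finset.mul_expect, hmean,
    Fintype.expect_const]
  linarith

end DecidableEq

theorem proportion_cycleCount_deviation_le {L : Finset ℕ} (hL : L ⊆ Finset.Icc 1 (Fintype.card α))
    {m : ℝ} (hm : 0 < m) (h : 0 < reciprocalSum L) :
    proportion (fun σ : Perm α => reciprocalSum L / m ≤ |cycleCount L σ - reciprocalSum L|) ≤
      m ^ 2 / reciprocalSum L := by
  classical
  have hcheb := (proportion_chebyshev (f := fun σ : Perm α => cycleCount L σ)
    (m := reciprocalSum L) (div_pos h hm).le).trans (expect_cycleCount_sub_sq_le hL)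
  rw [← le_div_iff₀ (by positivity)] at hcheb
  refine hcheb.trans_eq ?_
  field_simp

end CycleStatistics

section InvariantSets

variable {α : Type*}

/-- The permutation `σ` preserves some set of exactly `k` points. -/
def HasInvariantSet (k : ℕ) (σ : Perm α) : Prop :=
  ∃ S : Finset α, S.card = k ∧ ∀ x, σ x ∈ S ↔ x ∈ S

theorem HasInvariantSet.conj {k : ℕ} {σ : Perm α} (h : HasInvariantSet k σ) (g : Perm α) :
    HasInvariantSet k (g * σ * g⁻¹) := by
  obtain ⟨S, hS, hinv⟩ := h
  have hmem (x : α) : x ∈ S.map g.toEmbedding ↔ g⁻¹ x ∈ S := Finset.mem_map_equiv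
  refine ⟨S.map g.toEmbedding, (Finset.card_map _).trans hS, fun x => ?_⟩
  rw [hmem, hmem, ← hinv (g⁻¹ x), ← Perm.mul_apply, ← Perm.mul_apply, mul_assoc,
    inv_mul_cancel_left]

theorem minimalPeriod_coe_of_semiconj {p : α → Prop} {τ : Perm {x // p x}} {σ : Perm α}
    (h : Semiconj ((↑) : {x // p x} → α) τ σ) (x : {x // p x}) :
    minimalPeriod σ x = minimalPeriod τ x := by
  refine minimalPeriod_eq_minimalPeriod_iff.2 fun n => ?_
  rw [IsPeriodicPt, IsPeriodicPt, IsFixedPt, IsFixedPt, ← (h.iterate_right n) x, Subtype.ext_iff]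

variable [Fintype α]

theorem cycleCount_subtypeCongr (L : Finset ℕ) {p : α → Prop} [DecidablePred p]
    [Fintype {x // p x}] [Fintype {x // ¬ p x}] (τ : Perm {x // p x}) (τ' : Perm {x // ¬ p x}) :
    cycleCount L (τ.subtypeCongr τ') = cycleCount L τ + cycleCount L τ' := by
  have hl := minimalPeriod_coe_of_semiconj (σ := τ.subtypeCongr τ') (τ := τ) fun x => by simp
  have hr := minimalPeriod_coe_of_semiconj (σ := τ.subtypeCongr τ') (τ := τ') fun x => by simp
  simp only [cycleCount, Finset.sum_filter, ← hl, ← hr]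
  rw [← Fintype.sum_subtype_add_sum_subtype p]
  congr 1 <;> exact Finset.sum_congr (by ext; simp) fun _ _ => rfl

section DecidableEq

variable [DecidableEq α]

theorem proportion_preserving_and_le (S : Finset α) (R : Perm α → Prop) :
    proportion (fun σ : Perm α => (∀ x, σ x ∈ S ↔ x ∈ S) ∧ R σ) ≤
      proportion (fun τ : Perm {x // x ∈ S} × Perm {x // x ∉ S} => R (τ.1.subtypeCongr τ.2)) /
        (Fintype.card α).choose S.card := by
  have hpres (τ : Perm {x // x ∈ S} × Perm {x // x ∉ S}) (x : α) :
      τ.1.subtypeCongr τ.2 x ∈ S ↔ x ∈ S := by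
    by_cases hx : x ∈ S
    · simp [Perm.subtypeCongr.left_apply _ _ hx, hx]
    · simp [Perm.subtypeCongr.right_apply _ _ hx, hx, (τ.2 ⟨x, hx⟩).2]
  have hsurj : Surjective (fun τ : {τ : Perm {x // x ∈ S} × Perm {x // x ∉ S} //
      R (τ.1.subtypeCongr τ.2)} => (⟨τ.1.1.subtypeCongr τ.1.2, hpres τ.1, τ.2⟩ :
        {σ : Perm α // (∀ x, σ x ∈ S ↔ x ∈ S) ∧ R σ})) := by
    rintro ⟨σ, hσ, hR⟩
    have hσ_eq : (σ.subtypePerm hσ).subtypeCongr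
        (σ.subtypePerm (p := (· ∉ S)) fun x => not_congr (hσ x)) = σ := by
      ext x
      by_cases hx : x ∈ S <;> simp [hx]
    exact ⟨⟨(_, _), hσ_eq.symm ▸ hR⟩, Subtype.ext hσ_eq⟩
  have hperm : Nat.card (Perm α) = (Fintype.card α).choose S.card *
      Nat.card (Perm {x // x ∈ S} × Perm {x // x ∉ S}) := by
    rw [Nat.card_prod, Nat.card_perm, Nat.card_perm, Nat.card_perm, Nat.card_eq_fintype_card,
      Nat.card_eq_fintype_card, Nat.card_eq_fintype_card, Fintype.card_subtype_compl,
      Fintype.card_coe, ← mul_assoc, Nat.choose_mul_factorial_mul_factorial S.card_le_univ]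
  rw [proportion, proportion, hperm, div_div, Nat.cast_mul, mul_comm (Nat.cast (Nat.choose _ _))]
  gcongr
  exact Nat.card_le_card_of_surjective _ hsurj

theorem proportion_exists_preserving_and_le {k : ℕ} (hk : k ≤ Fintype.card α) {R : Perm α → Prop}
    {c : ℝ} (hR : ∀ S : Finset α, S.card = k →
      proportion (fun τ : Perm {x // x ∈ S} × Perm {x // x ∉ S} => R (τ.1.subtypeCongr τ.2)) ≤ c) :
    proportion (fun σ : Perm α => ∃ S : Finset α, S.card = k ∧ (∀ x, σ x ∈ S ↔ x ∈ S) ∧ R σ) ≤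
      c := by
  have hchoose : (0 : ℝ) < (Fintype.card α).choose k := by exact_mod_cast Nat.choose_pos hk
  have hterm : ∀ S ∈ Finset.univ.powersetCard k,
      proportion (fun σ : Perm α => (∀ x, σ x ∈ S ↔ x ∈ S) ∧ R σ) ≤
        c / (Fintype.card α).choose k := by
    intro S hS
    have hS := Finset.mem_powersetCard_univ.1 hS
    refine (proportion_preserving_and_le S R).trans ?_
    rw [hS]
    gcongr
    exact hR S hS
  calc proportion (fun σ : Perm α => ∃ S : Finset α, S.card = k ∧ (∀ x, σ x ∈ S ↔ x ∈ S) ∧ R σ)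
      ≤ ∑ S ∈ Finset.univ.powersetCard k,
          proportion (fun σ : Perm α => (∀ x, σ x ∈ S ↔ x ∈ S) ∧ R σ) := by
        simpa only [Finset.mem_powersetCard_univ] using proportion_exists_le
          (Finset.univ.powersetCard k) fun S (σ : Perm α) => (∀ x, σ x ∈ S ↔ x ∈ S) ∧ R σ
    _ ≤ ∑ _S ∈ Finset.univ.powersetCard k, c / (Fintype.card α).choose k :=
        Finset.sum_le_sum hterm
    _ = c := by
        rw [Finset.sum_const, Finset.card_powersetCard, Finset.card_univ, nsmul_eq_mul,
          mul_div_cancel₀ _ hchoose.ne']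

theorem proportion_subtypeCongr_few_cycles_le {k : ℕ} (hk : 1 ≤ k) (hk2 : 2 * k ≤ Fintype.card α)
    {S : Finset α} (hS : S.card = k) :
    proportion (fun τ : Perm {x // x ∈ S} × Perm {x // x ∉ S} =>
      cycleCount (Finset.Icc 1 k) (τ.1.subtypeCongr τ.2) <
        3 / 2 * reciprocalSum (Finset.Icc 1 k)) ≤ 32 / reciprocalSum (Finset.Icc 1 k) := by
  have hpos := reciprocalSum_Icc_one_pos hk
  have hcard : Fintype.card {x // x ∈ S} = k := by rw [Fintype.card_coe, hS]
  have hcard' : k ≤ Fintype.card {x // x ∉ S} := by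
    rw [Fintype.card_subtype_compl, hcard]
    omega
  have hdev := proportion_cycleCount_deviation_le (α := {x // x ∈ S}) (L := Finset.Icc 1 k)
    (Finset.Icc_subset_Icc_right hcard.ge) four_pos hpos
  have hdev' := proportion_cycleCount_deviation_le (α := {x // x ∉ S}) (L := Finset.Icc 1 k)
    (Finset.Icc_subset_Icc_right hcard') four_pos hpos
  rw [← proportion_fst (β := Perm {x // x ∉ S})] at hdev
  rw [← proportion_snd (α := Perm {x // x ∈ S})] at hdev'
  refine (proportion_le_add fun τ hτ => ?_).trans
    ((add_le_add hdev hdev').trans_eq (by ring))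
  by_contra! hcon
  rw [cycleCount_subtypeCongr] at hτ
  linarith [(abs_lt.1 hcon.1).1, (abs_lt.1 hcon.2).1]

end DecidableEq

theorem proportion_hasInvariantSet_le {k : ℕ} (hk : 1 ≤ k) (hk2 : 2 * k ≤ Fintype.card α) :
    proportion (fun σ : Perm α => HasInvariantSet k σ) ≤
      36 / reciprocalSum (Finset.Icc 1 k) := by
  classical
  have hpos := reciprocalSum_Icc_one_pos hk
  have hmany := proportion_cycleCount_deviation_le (α := α) (L := Finset.Icc 1 k)
    (Finset.Icc_subset_Icc_right (by omega)) two_pos hpos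
  have hfew := proportion_exists_preserving_and_le (by omega)
    (R := fun σ : Perm α => cycleCount (Finset.Icc 1 k) σ <
      3 / 2 * reciprocalSum (Finset.Icc 1 k))
    fun S hS => proportion_subtypeCongr_few_cycles_le hk hk2 hS
  refine (proportion_le_add fun σ hσ => ?_).trans ((add_le_add hmany hfew).trans_eq (by ring))
  obtain ⟨S, hS, hσS⟩ := hσ
  rcases lt_or_ge (cycleCount (Finset.Icc 1 k) σ)
      (3 / 2 * reciprocalSum (Finset.Icc 1 k)) with hlt | hge
  · exact .inr ⟨S, hS, hσS, hlt⟩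
  · exact .inl (by rw [le_abs]; left; linarith)

end InvariantSets

section PrimeCyclePowers

theorem reciprocalSum_multiples_le {p : ℕ} (hp : 0 < p) (m : ℕ) :
    reciprocalSum ((Finset.Icc 1 m).filter (p ∣ ·)) ≤
      (p : ℝ)⁻¹ * reciprocalSum (Finset.Icc 1 m) := by
  have hsub : (Finset.Icc 1 m).filter (p ∣ ·) ⊆ (Finset.Icc 1 m).image (p * ·) := by
    intro l hl
    obtain ⟨hl, j, rfl⟩ := Finset.mem_filter.1 hl
    obtain ⟨h1, hm⟩ := Finset.mem_Icc.1 hl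
    exact Finset.mem_image_of_mem _ (Finset.mem_Icc.2
      ⟨Nat.pos_of_mul_pos_left h1, (Nat.le_mul_of_pos_left j hp).trans hm⟩)
  refine (Finset.sum_le_sum_of_subset_of_nonneg hsub fun _ _ _ => by positivity).trans_eq ?_
  rw [Finset.sum_image fun i _ j _ hij => Nat.eq_of_mul_eq_mul_left hp hij, reciprocalSum,
    Finset.mul_sum]
  exact Finset.sum_congr rfl fun j _ => by push_cast; rw [mul_inv]

variable {α : Type*} [Fintype α]

theorem proportion_exists_dvd_minimalPeriod_le {P : Finset ℕ}
    (hP : P ⊆ Finset.Icc 1 (Fintype.card α)) :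
    proportion (fun σ : Perm α => ∃ x y, ¬ σ.SameCycle x y ∧ minimalPeriod σ x ∈ P ∧
      minimalPeriod σ x ∣ minimalPeriod σ y) ≤
      reciprocalSum (Finset.Icc 1 (Fintype.card α)) * ∑ p ∈ P, ((p : ℝ) ^ 2)⁻¹ := by
  classical
  set I := Finset.Icc 1 (Fintype.card α)
  set W : ℕ → ℕ → ℝ := fun l l' => if l ∈ P ∧ l ∣ l' then 1 else 0 with hW
  have hW0 (l l' : ℕ) : 0 ≤ W l l' := by
    simp only [hW]
    split_ifs <;> norm_num
  have hinner : ∀ p ∈ P, ∑ l ∈ I, W p l / (p * l) ≤ reciprocalSum I * ((p : ℝ) ^ 2)⁻¹ := by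
    intro p hp
    have hterm (l : ℕ) :
        W p l / (p * l) = (p : ℝ)⁻¹ * if p ∣ l then (l : ℝ)⁻¹ else 0 := by
      by_cases h : p ∣ l <;> simp [hW, hp, h, mul_comm]
    simp only [hterm]
    rw [← Finset.mul_sum, ← Finset.sum_filter]
    refine (mul_le_mul_of_nonneg_left (reciprocalSum_multiples_le
      (Finset.mem_Icc.1 (hP hp)).1 _) (by positivity)).trans_eq ?_
    ring
  rw [← mul_one (proportion _)]
  calc _ ≤ 𝔼 σ : Perm α, cyclePairSum W σ := by
        refine proportion_mul_le_expect (fun σ => Finset.sum_nonneg fun x _ =>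
          div_nonneg (hW0 _ _) (by positivity)) fun σ => ?_
        rintro ⟨x, y, hxy, hx, hdvd⟩
        exact (if_pos ⟨hx, hdvd⟩).ge.trans (le_cyclePairSum hW0 hxy)
    _ ≤ ∑ l ∈ I, ∑ l' ∈ I, W l l' / (l * l') := expect_cyclePairSum_le hW0
    _ = ∑ p ∈ P, ∑ l ∈ I, W p l / (p * l) := by
        refine (Finset.sum_subset hP fun l _ hl => Finset.sum_eq_zero fun l' _ => ?_).symm
        simp only [hW, if_neg (fun h : l ∈ P ∧ l ∣ l' => hl h.1), zero_div]
    _ ≤ reciprocalSum I * ∑ p ∈ P, ((p : ℝ) ^ 2)⁻¹ := by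
        rw [Finset.mul_sum]
        exact Finset.sum_le_sum hinner

variable [DecidableEq α]

theorem cycleOf_mem_zpowers_of_coprime {σ : Perm α} {x : α}
    (h : ∀ y, ¬ σ.SameCycle x y → (minimalPeriod σ x).Coprime (minimalPeriod σ y)) :
    σ.cycleOf x ∈ Subgroup.zpowers σ := by
  set r := ∏ y with ¬ σ.SameCycle x y, minimalPeriod σ y
  have hco : (minimalPeriod σ x).Coprime r :=
    Nat.Coprime.prod_right fun y hy => h y (Finset.mem_filter.1 hy).2
  obtain ⟨s, hs1, hs0⟩ := Nat.chineseRemainder hco 1 0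
  have hiterate {y : α} {i j : ℕ} (hij : i ≡ j [MOD minimalPeriod σ y]) : σ^[i] y = σ^[j] y := by
    rw [← iterate_mod_minimalPeriod_eq (n := i), hij, iterate_mod_minimalPeriod_eq]
  refine ⟨s, Perm.ext fun y => ?_⟩
  simp only [zpow_natCast, ← Perm.iterate_eq_pow, Perm.cycleOf_apply]
  split_ifs with hy
  · rw [minimalPeriod_eq_of_sameCycle hy] at hs1
    exact hiterate hs1
  · have hdvd : minimalPeriod σ y ∣ r :=
      Finset.dvd_prod_of_mem _ (Finset.mem_filter.2 ⟨Finset.mem_univ y, hy⟩)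
    exact hiterate (j := 0) (hs0.of_dvd hdvd)

theorem card_support_cycleOf {σ : Perm α} {x : α} (hx : σ x ≠ x) :
    (σ.cycleOf x).support.card = minimalPeriod σ x := by
  rw [← card_sameCycle]
  refine congrArg Finset.card (Finset.ext fun y => ?_)
  rw [Perm.mem_support_cycleOf_iff' hx, Finset.mem_filter, and_iff_right (Finset.mem_univ y)]

/-- Some power of `σ` is a cycle of prime length in the interval `[a, b]`. -/
def HasPrimeCyclePower (a b : ℕ) (σ : Perm α) : Prop :=
  ∃ c ∈ Subgroup.zpowers σ, c.IsCycle ∧ c.support.card.Prime ∧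
    a ≤ c.support.card ∧ c.support.card ≤ b

theorem hasPrimeCyclePower_minimalPeriod {σ : Perm α} {x : α} (hp : (minimalPeriod σ x).Prime)
    (h : ∀ y, ¬ σ.SameCycle x y → ¬ minimalPeriod σ x ∣ minimalPeriod σ y) :
    HasPrimeCyclePower (minimalPeriod σ x) (minimalPeriod σ x) σ := by
  have hx : σ x ≠ x := fun hfix => hp.ne_one (minimalPeriod_eq_one_iff_isFixedPt.2 hfix)
  refine ⟨σ.cycleOf x, cycleOf_mem_zpowers_of_coprime fun y hy =>
    hp.coprime_iff_not_dvd.2 (h y hy), σ.isCycle_cycleOf hx, ?_⟩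
  rw [card_support_cycleOf hx]
  exact ⟨hp, le_rfl, le_rfl⟩

theorem HasPrimeCyclePower.mono {a b a' b' : ℕ} {σ : Perm α} (h : HasPrimeCyclePower a b σ)
    (ha : a' ≤ a) (hb : b ≤ b') : HasPrimeCyclePower a' b' σ := by
  obtain ⟨c, hc, hcycle, hp, hac, hcb⟩ := h
  exact ⟨c, hc, hcycle, hp, ha.trans hac, hcb.trans hb⟩

theorem HasPrimeCyclePower.conj {a b : ℕ} {σ : Perm α} (h : HasPrimeCyclePower a b σ)
    (g : Perm α) : HasPrimeCyclePower a b (g * σ * g⁻¹) := by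
  obtain ⟨c, ⟨i, rfl⟩, hcycle, hc⟩ := h
  refine ⟨g * σ ^ i * g⁻¹, ⟨i, conj_zpow⟩, hcycle.conj, ?_⟩
  rwa [Perm.card_support_conj]

theorem proportion_not_hasPrimeCyclePower_le {a b : ℕ} {P : Finset ℕ}
    (hP : ∀ p ∈ P, p.Prime ∧ a ≤ p ∧ p ≤ b) (hb : b ≤ Fintype.card α) (hpos : 0 < reciprocalSum P) :
    proportion (fun σ : Perm α => ¬ HasPrimeCyclePower a b σ) ≤ (reciprocalSum P)⁻¹ +
      reciprocalSum (Finset.Icc 1 (Fintype.card α)) * ∑ p ∈ P, ((p : ℝ) ^ 2)⁻¹ := by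
  have hPn : P ⊆ Finset.Icc 1 (Fintype.card α) := fun p hp =>
    Finset.mem_Icc.2 ⟨(hP p hp).1.one_le, (hP p hp).2.2.trans hb⟩
  have hnone := proportion_cycleCount_deviation_le hPn one_pos hpos
  rw [div_one, one_pow, one_div] at hnone
  refine (proportion_le_add fun σ hσ => ?_).trans
    (add_le_add hnone (proportion_exists_dvd_minimalPeriod_le hPn))
  by_cases hx : ∃ x, minimalPeriod σ x ∈ P
  · obtain ⟨x, hx⟩ := hx
    right
    by_contra! hcon
    have hprime := hP _ hx
    exact hσ ((hasPrimeCyclePower_minimalPeriod hprime.1 fun y hy => hcon x y hy hx).mono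
      hprime.2.1 hprime.2.2)
  · left
    have hzero : cycleCount P σ = 0 :=
      Finset.sum_eq_zero fun x hxP => (hx ⟨x, (Finset.mem_filter.1 hxP).2⟩).elim
    rw [hzero, zero_sub, abs_neg]
    exact le_abs_self _

end PrimeCyclePowers

section PrimeReciprocals

/-- The primes in the interval `(m, n]`. -/
def primesIoc (m n : ℕ) : Finset ℕ := (Finset.Ioc m n).filter Nat.Prime

theorem sum_primesIoc_add {m n k : ℕ} (hmn : m ≤ n) (hnk : n ≤ k) (f : ℕ → ℝ) :
    ∑ p ∈ primesIoc m n, f p + ∑ p ∈ primesIoc n k, f p = ∑ p ∈ primesIoc m k, f p := by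
  simp only [primesIoc, Finset.sum_filter]
  exact Finset.sum_Ioc_consecutive _ hmn hnk

theorem theta_sub_le {m n : ℕ} (hmn : m ≤ n) :
    Chebyshev.theta n - Chebyshev.theta m ≤ n * Real.log n * reciprocalSum (primesIoc m n) := by
  have htheta (k : ℕ) : Chebyshev.theta k = ∑ p ∈ primesIoc 0 k, Real.log p := by
    rw [Chebyshev.theta, Nat.floor_natCast, primesIoc]
  rw [htheta, htheta, ← sum_primesIoc_add (Nat.zero_le m) hmn, add_sub_cancel_left, reciprocalSum,
    Finset.mul_sum]
  refine Finset.sum_le_sum fun p hp => ?_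
  obtain ⟨hpn, hprime⟩ := Finset.mem_filter.1 hp
  have hp0 : (0 : ℝ) < p := Nat.cast_pos.2 hprime.pos
  have hle : (p : ℝ) ≤ n := Nat.cast_le.2 (Finset.mem_Ioc.1 hpn).2
  rw [← div_eq_mul_inv, le_div_iff₀ hp0, mul_comm]
  gcongr

theorem eventually_log_le_sqrt_div : ∀ᶠ x : ℝ in atTop, Real.log x ≤ √x / 8 := by
  filter_upwards [(isLittleO_log_rpow_atTop (r := 1 / 2) (by norm_num)).bound
    (show (0 : ℝ) < 1 / 8 by norm_num), eventually_ge_atTop 1] with x hx hx1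
  rwa [Real.norm_of_nonneg (Real.log_nonneg hx1), Real.norm_of_nonneg (by positivity),
    ← Real.sqrt_eq_rpow, one_div_mul_eq_div] at hx

theorem eventually_le_theta_sub :
    ∀ᶠ m : ℕ in atTop, (m : ℝ) ≤ Chebyshev.theta (8 * m : ℕ) - Chebyshev.theta m := by
  have htendsto : Tendsto (fun m : ℕ => ((8 * m : ℕ) : ℝ)) atTop atTop :=
    tendsto_natCast_atTop_atTop.comp (tendsto_id.const_mul_atTop' (by norm_num))
  filter_upwards [htendsto.eventually eventually_log_le_sqrt_div,
    htendsto.eventually (eventually_ge_atTop 4)] with m hlog h4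
  have hlower := Chebyshev.theta_ge (8 * m)
  have hupper := Chebyshev.theta_le_log4_mul_x (Nat.cast_nonneg' (α := ℝ) m)
  have hm : ((8 * m : ℕ) : ℝ) = 8 * m := by push_cast; rfl
  set y : ℝ := ((8 * m : ℕ) : ℝ)
  have hlog4 : Real.log 4 = 2 * Real.log 2 := by
    rw [show (4 : ℝ) = 2 ^ 2 by norm_num, Real.log_pow]; norm_num
  have hlog_succ : Real.log (y + 1) ≤ 2 * Real.log y := by
    rw [show 2 * Real.log y = Real.log (y ^ 2) by rw [Real.log_pow]; norm_num]
    exact Real.log_le_log (by linarith) (by nlinarith)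
  have hsqrt : 2 ≤ √y := Real.le_sqrt_of_sq_le (by linarith)
  have hmain : √y * Real.log y ≤ y / 8 := by
    nlinarith [Real.mul_self_sqrt (show 0 ≤ y by linarith)]
  have hminor : 2 * Real.log y ≤ √y * Real.log y :=
    mul_le_mul_of_nonneg_right hsqrt (Real.log_nonneg (by linarith))
  rw [hlog4] at hupper
  nlinarith [Real.log_two_gt_d9]

theorem eventually_inv_le_reciprocalSum_primesIoc_pow :
    ∀ᶠ j : ℕ in atTop, ((j + 1 : ℕ) : ℝ)⁻¹ / 24 ≤
      reciprocalSum (primesIoc (8 ^ j) (8 ^ (j + 1))) := by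
  filter_upwards [(tendsto_pow_atTop_atTop_of_one_lt (by norm_num : 1 < 8)).eventually
    eventually_le_theta_sub] with j hj
  have hlog8 : Real.log 8 ≤ 3 := by
    rw [show (8 : ℝ) = 2 ^ 3 by norm_num, Real.log_pow]
    push_cast
    linarith [Real.log_two_lt_d9]
  have hle := hj.trans (theta_sub_le (Nat.le_mul_of_pos_left (8 ^ j) (by norm_num)))
  rw [← pow_succ'] at hle
  set s := reciprocalSum (primesIoc (8 ^ j) (8 ^ (j + 1)))
  have hs : 0 ≤ s := Finset.sum_nonneg fun _ _ => by positivity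
  have hlog : Real.log ((8 ^ (j + 1) : ℕ) : ℝ) ≤ (j + 1 : ℕ) * 3 := by
    rw [Nat.cast_pow, Real.log_pow]
    exact mul_le_mul_of_nonneg_left hlog8 (Nat.cast_nonneg' _)
  have hpow : (0 : ℝ) < 8 ^ j := by positivity
  have hone : 1 ≤ 8 * ((j + 1 : ℕ) * 3) * s := by
    refine le_of_mul_le_mul_left ?_ hpow
    calc (8 : ℝ) ^ j * 1 ≤ (8 ^ (j + 1) : ℕ) * Real.log ((8 ^ (j + 1) : ℕ) : ℝ) * s := by
          simpa using hle
      _ ≤ (8 ^ (j + 1) : ℕ) * ((j + 1 : ℕ) * 3) * s := by gcongr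
      _ = 8 ^ j * (8 * ((j + 1 : ℕ) * 3) * s) := by push_cast; ring
  rw [div_le_iff₀ (by norm_num), inv_le_iff_one_le_mul₀ (by positivity)]
  linarith

theorem exists_forall_harmonic_sub_le_reciprocalSum_primesIoc :
    ∃ a₀ : ℕ, ∀ a ≥ a₀, ∀ b ≥ a, ((harmonic b : ℝ) - harmonic a) / 24 ≤
      reciprocalSum (primesIoc (8 ^ a) (8 ^ b)) := by
  obtain ⟨a₀, hblock⟩ := eventually_atTop.1 eventually_inv_le_reciprocalSum_primesIoc_pow
  refine ⟨a₀, fun a ha b hab => ?_⟩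
  induction b, hab using Nat.le_induction with
  | base => simp [primesIoc, reciprocalSum]
  | succ b hab ih =>
    have hb := hblock b (ha.trans hab)
    have hpow {i j : ℕ} (hij : i ≤ j) : 8 ^ i ≤ 8 ^ j := Nat.pow_le_pow_right (by norm_num) hij
    rw [reciprocalSum, ← sum_primesIoc_add (hpow hab) (hpow b.le_succ), harmonic_succ]
    simp only [reciprocalSum] at hb ih
    push_cast at hb ⊢
    linarith

theorem sum_primesIoc_inv_sq_le {m : ℕ} (hm : 0 < m) (n : ℕ) :
    ∑ p ∈ primesIoc m n, ((p : ℝ) ^ 2)⁻¹ ≤ (m : ℝ)⁻¹ := by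
  rcases le_total m n with hmn | hnm
  · calc ∑ p ∈ primesIoc m n, ((p : ℝ) ^ 2)⁻¹
        ≤ ∑ p ∈ Finset.Ioc m n, ((p : ℝ) ^ 2)⁻¹ :=
          Finset.sum_le_sum_of_subset_of_nonneg (Finset.filter_subset _ _)
            fun _ _ _ => by positivity
      _ ≤ (m : ℝ)⁻¹ - (n : ℝ)⁻¹ := sum_Ioc_inv_sq_le_sub hm.ne' hmn
      _ ≤ (m : ℝ)⁻¹ := sub_le_self _ (by positivity)
  · rw [primesIoc, Finset.Ioc_eq_empty_of_le hnm, Finset.filter_empty, Finset.sum_empty]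
    positivity

theorem tendsto_reciprocalSum_primesIoc_pow_sq :
    Tendsto (fun a : ℕ => reciprocalSum (primesIoc (8 ^ a) (8 ^ a ^ 2))) atTop atTop := by
  obtain ⟨a₀, hblocks⟩ := exists_forall_harmonic_sub_le_reciprocalSum_primesIoc
  have hlog : Tendsto (fun a : ℕ => (Real.log a - 1) / 24) atTop atTop :=
    ((tendsto_atTop_add_const_right _ (-1)
      (Real.tendsto_log_atTop.comp tendsto_natCast_atTop_atTop))).atTop_div_const (by norm_num)
  refine tendsto_atTop_mono' _ ?_ hlog
  filter_upwards [eventually_ge_atTop a₀, eventually_ge_atTop 1] with a ha ha1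
  have hsum := hblocks a ha (a ^ 2) (Nat.le_self_pow two_ne_zero a)
  have hlower := log_add_one_le_harmonic (a ^ 2)
  have hupper := harmonic_le_one_add_log a
  have ha0 : (0 : ℝ) < a := Nat.cast_pos.2 ha1
  have hlog_sq : 2 * Real.log a ≤ Real.log ((a ^ 2 : ℕ) + 1) := by
    rw [show 2 * Real.log a = Real.log ((a : ℝ) ^ 2) by rw [Real.log_pow]; norm_num]
    exact Real.log_le_log (pow_pos ha0 2) (by push_cast; linarith)
  push_cast at hlower hlog_sq
  linarith

theorem reciprocalSum_Icc_one_le {a n : ℕ} (hn0 : 0 < n) (hn : n ≤ 2 * 8 ^ (a + 1) ^ 2) :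
    reciprocalSum (Finset.Icc 1 n) ≤ 2 + 3 * ((a : ℝ) + 1) ^ 2 := by
  have hlog : Real.log n ≤ Real.log (2 * 8 ^ (a + 1) ^ 2) :=
    Real.log_le_log (Nat.cast_pos.2 hn0) (by exact_mod_cast hn)
  rw [Real.log_mul (by norm_num) (by positivity), show (8 : ℝ) = 2 ^ 3 by norm_num, ← pow_mul,
    Real.log_pow] at hlog
  push_cast at hlog
  rw [reciprocalSum_Icc_one_eq_harmonic]
  nlinarith [harmonic_le_one_add_log n, Real.log_two_lt_d9, sq_nonneg ((a : ℝ) + 1)]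

theorem tendsto_polynomial_mul_inv_pow :
    Tendsto (fun a : ℕ => (2 + 3 * ((a : ℝ) + 1) ^ 2) * ((8 : ℝ) ^ a)⁻¹) atTop (𝓝 0) := by
  have hpow (k : ℕ) : Tendsto (fun a : ℕ => (a : ℝ) ^ k * ((8 : ℝ) ^ a)⁻¹) atTop (𝓝 0) := by
    simpa only [div_eq_mul_inv] using
      tendsto_pow_const_div_const_pow_of_one_lt k (r := (8 : ℝ)) (by norm_num)
  have hsum := (((hpow 2).const_mul 3).add ((hpow 1).const_mul 6)).add ((hpow 0).const_mul 5)
  simp only [mul_zero, add_zero] at hsum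
  exact hsum.congr fun a => by ring

theorem eventually_exists_primes {ε : ℝ} (hε : 0 < ε) (Y : ℕ) :
    ∀ᶠ n : ℕ in atTop, ∃ P : Finset ℕ, (∀ p ∈ P, p.Prime ∧ Y ≤ p ∧ p ≤ n / 2) ∧
      0 < reciprocalSum P ∧
      (reciprocalSum P)⁻¹ + reciprocalSum (Finset.Icc 1 n) * ∑ p ∈ P, ((p : ℝ) ^ 2)⁻¹ ≤ ε := by
  have hlog : Tendsto (fun n : ℕ => Nat.log 8 (n / 2)) atTop atTop := by
    refine tendsto_atTop.2 fun b => ?_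
    filter_upwards [eventually_ge_atTop (2 * 8 ^ b)] with n hn
    exact Nat.le_log_of_pow_le (by norm_num) (by omega)
  have hsqrt : Tendsto Nat.sqrt atTop atTop :=
    tendsto_atTop.2 fun b => (eventually_ge_atTop (b * b)).mono fun n => Nat.le_sqrt.2
  have hlarge := (hsqrt.comp hlog).eventually <|
    (tendsto_reciprocalSum_primesIoc_pow_sq.eventually_gt_atTop 0).and <|
    (tendsto_reciprocalSum_primesIoc_pow_sq.inv_tendsto_atTop.eventually_le_const
      (half_pos hε)).and <|
    (tendsto_polynomial_mul_inv_pow.eventually_le_const (half_pos hε)).and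
    (eventually_ge_atTop Y)
  filter_upwards [hlarge, eventually_ge_atTop 2] with n hn hn2
  set J := Nat.log 8 (n / 2)
  obtain ⟨hpos, hinv, hpoly, hY⟩ := hn
  simp only [comp_apply, Pi.inv_apply] at hpos hinv hpoly hY
  set a := Nat.sqrt J
  have hpow : 8 ^ a ^ 2 ≤ n / 2 := (Nat.pow_le_pow_right (by norm_num) (Nat.sqrt_le' J)).trans
    (Nat.pow_log_le_self 8 (by omega))
  have hn8 : n ≤ 2 * 8 ^ (a + 1) ^ 2 := by
    have hJ : n / 2 < 8 ^ (J + 1) := Nat.lt_pow_succ_log_self (by norm_num) _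
    have ha : 8 ^ (J + 1) ≤ 8 ^ (a + 1) ^ 2 :=
      Nat.pow_le_pow_right (by norm_num) (Nat.lt_succ_sqrt' J)
    omega
  refine ⟨primesIoc (8 ^ a) (8 ^ a ^ 2), fun p hp => ?_, hpos, ?_⟩
  · obtain ⟨hpI, hprime⟩ := Finset.mem_filter.1 hp
    obtain ⟨hap, hpa⟩ := Finset.mem_Ioc.1 hpI
    exact ⟨hprime, (hY.trans (Nat.lt_pow_self (by norm_num)).le).trans hap.le, hpa.trans hpow⟩
  · calc _ ≤ ε / 2 + (2 + 3 * ((a : ℝ) + 1) ^ 2) * ((8 : ℝ) ^ a)⁻¹ := by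
          gcongr
          · exact reciprocalSum_Icc_one_le (by omega) hn8
          · exact_mod_cast sum_primesIoc_inv_sq_le (pow_pos (by norm_num) a) (8 ^ a ^ 2)
      _ ≤ ε := by linarith

theorem eventually_proportion_not_hasPrimeCyclePower_le {ε : ℝ} (hε : 0 < ε) (Y : ℕ) :
    ∀ᶠ n : ℕ in atTop,
      proportion (fun σ : Perm (Fin n) => ¬ HasPrimeCyclePower Y (n / 2) σ) ≤ ε := by
  filter_upwards [eventually_exists_primes hε Y] with n hn
  obtain ⟨P, hP, hpos, hle⟩ := hn
  have hcard : n / 2 ≤ Fintype.card (Fin n) := by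
    rw [Fintype.card_fin]
    exact Nat.div_le_self n 2
  have hbound := proportion_not_hasPrimeCyclePower_le hP hcard hpos
  rw [Fintype.card_fin] at hbound
  exact hbound.trans hle

end PrimeReciprocals

section Jordan

open scoped Pointwise

variable {α : Type*} [Fintype α] [DecidableEq α] {K : Subgroup (Perm α)} {c : Perm α}

theorem isMultiplyPretransitive_of_prime_cycle (hK : IsPreprimitive K α) (hcK : c ∈ K)
    (hc : c.IsCycle) (hp : c.support.card.Prime) (hp2 : 2 * c.support.card ≤ Fintype.card α) :
    IsMultiplyPretransitive K α c.support.card := by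
  have htwo := hp.two_le
  have hsupp : ((c.support : Set α)ᶜ).ncard = Fintype.card α - c.support.card - 1 + 1 := by
    rw [Set.ncard_compl, Set.ncard_coe_finset, Nat.card_eq_fintype_card]
    omega
  have hprim : IsPreprimitive (fixingSubgroup K ((c.support : Set α)ᶜ))
      (SubMulAction.ofFixingSubgroup K ((c.support : Set α)ᶜ)) := by
    have := Perm.isPretransitive_of_isCycle_mem hc hcK
    refine IsPreprimitive.of_prime_card ?_
    convert! hp
    rw [← SetLike.coe_sort_coe, Nat.card_coe_set_eq]
    exact (congrArg Set.ncard (compl_compl _)).trans (Set.ncard_coe_finset _)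
  have hmult : IsMultiplyPreprimitive K α (Fintype.card α - c.support.card - 1 + 2) :=
    hK.isMultiplyPreprimitive hsupp (by rw [Nat.card_eq_fintype_card]; omega) hprim
  have := hmult.isMultiplyPretransitive
  exact isMultiplyPretransitive_of_le (n := Fintype.card α - c.support.card - 1 + 2)
    (by omega) (by rw [Nat.card_eq_fintype_card]; omega)

theorem isThreeCycle_commutator_swap {a b : α} (ha : c a ≠ a) (hb : c b = b) :
    (c * swap a b * c⁻¹ * swap a b).IsThreeCycle := by
  have hab : a ≠ b := fun h => ha (h ▸ hb)
  rw [← swap_apply_apply, hb, swap_comm (c a), swap_comm a]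
  exact Perm.isThreeCycle_swap_mul_swap_same (fun h => hab (c.injective (h.symm.trans hb.symm)))
    hab.symm ha

theorem alternatingGroup_le_of_prime_cycle (hK : IsPreprimitive K α) (hcK : c ∈ K)
    (hc : c.IsCycle) (hp : c.support.card.Prime) (hp2 : 2 * c.support.card ≤ Fintype.card α) :
    alternatingGroup α ≤ K := by
  have := isMultiplyPretransitive_of_prime_cycle hK hcK hc hp hp2
  obtain ⟨a, ha⟩ : ∃ a, c a ≠ a := hc.imp fun _ h => h.1
  obtain ⟨b, hb⟩ : ∃ b, b ∉ c.support := by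
    by_contra! hall
    have := hp.pos
    rw [Finset.eq_univ_of_forall hall, Finset.card_univ] at hp2 this
    omega
  let e : Fin c.support.card ↪ α :=
    (c.support.equivFin.symm.toEmbedding).trans (Embedding.subtype _)
  obtain ⟨g, hg⟩ := exists_smul_eq K e (e.trans (swap a b).toEmbedding)
  have hagree : ∀ t ∈ c.support, (g : Perm α) t = swap a b t := fun t ht => by
    have hgt : (g : Perm α) (e (c.support.equivFin ⟨t, ht⟩)) =
      swap a b (e (c.support.equivFin ⟨t, ht⟩)) := DFunLike.congr_fun hg _
    simpa [e] using hgt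
  -- `g` and `swap a b` agree on the support of `c`, hence conjugate `c⁻¹` to the same permutation
  have hdisj : Perm.Disjoint (swap a b * (g : Perm α)) c := fun t => by
    by_cases ht : t ∈ c.support
    · left
      rw [Perm.mul_apply, hagree t ht, ← Perm.mul_apply, swap_mul_self, Perm.one_apply]
    · exact Or.inr (Perm.notMem_support.1 ht)
  have hconj : c * swap a b * c⁻¹ * swap a b = c * (g * c⁻¹ * (g : Perm α)⁻¹) := by
    have hcomm := hdisj.commute.inv_right.eq
    rw [mul_assoc] at hcomm
    have hgc : (g : Perm α) * c⁻¹ = swap a b * (c⁻¹ * (swap a b * g)) := by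
      rw [← hcomm, ← mul_assoc, swap_mul_self, one_mul]
    rw [hgc]
    group
  refine Perm.alternatingGroup_le_of_isPreprimitive_of_isThreeCycle_mem hK
    (isThreeCycle_commutator_swap ha (Perm.notMem_support.1 hb)) ?_
  rw [hconj]
  exact K.mul_mem hcK (K.mul_mem (K.mul_mem g.2 (K.inv_mem hcK)) (K.inv_mem g.2))

theorem support_subset_of_isBlock {B : Set α} (hB : IsBlock K B) (hBn : B.Nontrivial)
    (hcK : c ∈ K) (hc : c.IsCycle) (hp : c.support.card.Prime) {t : α} (ht : t ∈ c.support)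
    (htB : t ∈ B) : (c.support : Set α) ⊆ B := by
  have hsubset {d : Perm α} (hdK : d ∈ K) (hd : d.IsCycle) (hdc : d.support = c.support) {s : α}
      (hs : s ∈ B) (hds : d s ∈ B) : (c.support : Set α) ⊆ B := by
    have hstab : (⟨d, hdK⟩ : K) ∈ stabilizer K B := hB.smul_eq_of_mem hs hds
    intro v hv
    rw [← hdc] at ht hv
    obtain ⟨i, rfl⟩ := hd.exists_pow_eq (Perm.mem_support.1 ht) (Perm.mem_support.1 hv)
    rw [← mem_stabilizer_iff.1 (pow_mem hstab i)]
    exact Set.smul_mem_smul_set htB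
  obtain ⟨u, hu, hut⟩ := hBn.exists_ne t
  by_cases hcu : c u = u
  · exact hsubset hcK hc rfl hu (by rwa [hcu])
  · obtain ⟨j, hj, hju⟩ := (hc.sameCycle (Perm.mem_support.1 ht) hcu).exists_pow_eq'
    have hj0 : 0 < j := Nat.pos_of_ne_zero fun h => hut (by rw [← hju, h, pow_zero, Perm.one_apply])
    rw [← hc.orderOf] at hp
    exact hsubset (K.pow_mem hcK j) (hc.isCycle_pow_pos_of_lt_prime_order hp j hj0 hj)
      (hc.support_pow_of_pos_of_lt_orderOf hj0 hj) htB (by rwa [hju])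

theorem le_ncard_and_hasInvariantSet_of_isBlock [IsPretransitive K α] {B : Set α}
    (hB : IsBlock K B) (hBn : B.Nontrivial) {a b : ℕ} {w : Perm α} (hw : w ∈ K)
    (h : HasPrimeCyclePower a b w) : a ≤ B.ncard ∧ HasInvariantSet B.ncard w := by
  classical
  obtain ⟨c, hcw, hc, hp, ha, -⟩ := h
  have hcK : c ∈ K := Subgroup.zpowers_le.2 hw hcw
  obtain ⟨t, ht⟩ : c.support.Nonempty := Finset.card_pos.1 hp.pos
  obtain ⟨s, hs⟩ := hBn.nonempty
  obtain ⟨k, rfl⟩ := exists_smul_eq K s t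
  have hncard : (k • B).ncard = B.ncard := Set.ncard_smul_set k B
  have hnontrivial : (k • B).Nontrivial := by
    rwa [← Set.one_lt_ncard_iff_nontrivial, hncard, Set.one_lt_ncard_iff_nontrivial]
  have hblock : IsBlock K (k • B) := hB.translate k
  have hsub : (c.support : Set α) ⊆ k • B :=
    support_subset_of_isBlock hblock hnontrivial hcK hc hp ht (Set.smul_mem_smul_set hs)
  have hwt : w (k • s) ∈ c.support := by
    have hcomm : Commute c w := by
      obtain ⟨i, rfl⟩ := hcw
      exact Commute.zpow_self w i
    rw [Perm.mem_support] at ht ⊢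
    rw [← Perm.mul_apply, hcomm.eq, Perm.mul_apply]
    exact w.injective.ne ht
  have hwB : (⟨w, hw⟩ : K) • k • B = k • B :=
    hblock.smul_eq_of_mem (Set.smul_mem_smul_set hs) (hsub hwt)
  refine ⟨?_, (k • B).toFinset, by rw [← hncard, Set.ncard_eq_toFinset_card'], fun x => ?_⟩
  · rw [← hncard]
    exact ha.trans ((Set.ncard_coe_finset _).symm.trans_le (Set.ncard_le_ncard hsub))
  · rw [Set.mem_toFinset, Set.mem_toFinset,
      ← Set.smul_mem_smul_set_iff (a := (⟨w, hw⟩ : K)) (x := x), hwB]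
    rfl

theorem exists_forall_hasPrimeCyclePower_imp_hasInvariantSet [IsPretransitive K α]
    (hK : ¬ alternatingGroup α ≤ K) :
    ∃ a, 2 * a ≤ Fintype.card α ∧ ∀ w ∈ K, ∀ Y,
      HasPrimeCyclePower Y (Fintype.card α / 2) w → Y ≤ a ∧ HasInvariantSet a w := by
  by_cases hprim : IsPreprimitive K α
  · refine ⟨0, Nat.zero_le _, fun w hw Y => ?_⟩
    rintro ⟨c, hc, hcycle, hp, -, hle⟩
    exact absurd (alternatingGroup_le_of_prime_cycle hprim (Subgroup.zpowers_le.2 hw hc) hcycle hp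
      (by omega)) hK
  · obtain ⟨B, hB, hBt⟩ : ∃ B : Set α, IsBlock K B ∧ ¬ IsTrivialBlock B := by
      by_contra! htrivial
      exact hprim ⟨fun {B} => htrivial B⟩
    simp only [IsTrivialBlock, not_or, Set.not_subsingleton_iff] at hBt
    have hcard : 2 * B.ncard ≤ Fintype.card α := by
      by_contra! hlt
      rw [← Nat.card_eq_fintype_card, mul_comm] at hlt
      exact hBt.2 (hB.eq_univ_of_card_lt hlt)
    exact ⟨B.ncard, hcard, fun w hw Y hY =>
      le_ncard_and_hasInvariantSet_of_isBlock hB hBt.1 hw hY⟩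

end Jordan

section PointStabilizers

open scoped Pointwise

variable {n : ℕ} {G : Subgroup (Perm (Fin n))} {Ω : Type*} [MulAction G Ω]

theorem IsKSetAction.compl {k l : ℕ} (h : IsKSetAction G Ω k) (hkl : l + k = n) :
    IsKSetAction G Ω l := by
  obtain ⟨e, he⟩ := h
  have hcard : l + k = Fintype.card (Fin n) := hkl.trans (Fintype.card_fin n).symm
  exact ⟨(Set.powersetCard.mulActionHom_compl G (Fin n) hcard).comp e,
    (Set.powersetCard.mulActionHom_compl_bijective G (Fin n) hcard).comp he⟩

theorem IsKSetAction.hasInvariantSet {k : ℕ} (h : IsKSetAction G Ω k) {w : G} {x : Ω}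
    (hx : w • x = x) : HasInvariantSet k (w : Perm (Fin n)) := by
  obtain ⟨e, -⟩ := h
  have hfix : w • (e x : Finset (Fin n)) = e x := by
    rw [← Set.powersetCard.coe_smul, ← map_smul, hx]
  refine ⟨e x, (e x).2, fun z => ?_⟩
  conv_lhs => rw [← hfix]
  exact Finset.smul_mem_smul_finset_iff w

theorem isKSetAction_of_stabilizer_eq (hn : 3 ≤ n) (hG : alternatingGroup (Fin n) ≤ G)
    [IsPretransitive G Ω] {k : ℕ} {x : Ω} {D : Set.powersetCard (Fin n) k}
    (h : stabilizer G D = stabilizer G x) : IsKSetAction G Ω k := by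
  choose γ hγ using fun y : Ω => exists_smul_eq G x y
  have hiff (g g' : G) : g • D = g' • D ↔ g • x = g' • x := by
    rw [← inv_smul_eq_iff, ← mul_smul, ← mem_stabilizer_iff, h, mem_stabilizer_iff, mul_smul,
      inv_smul_eq_iff]
  refine ⟨⟨fun y => γ y • D, fun g y => ?_⟩, fun y y' hy => ?_, fun E => ?_⟩
  · change γ (g • y) • D = g • γ y • D
    rw [← mul_smul, hiff, hγ, mul_smul, hγ]
  · rw [← hγ y, ← hγ y']
    exact (hiff _ _).1 hy
  · have := Set.powersetCard.isPretransitive_alternatingGroup (α := Fin n) (n := k)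
      (by rwa [Nat.card_fin])
    obtain ⟨g, hg⟩ := exists_smul_eq (alternatingGroup (Fin n)) D E
    exact ⟨(⟨g, hG g.2⟩ : G) • x, ((hiff _ _).2 (hγ _)).trans hg⟩

theorem exists_isKSetAction_of_not_isPretransitive (hn : 3 ≤ n)
    (hG : alternatingGroup (Fin n) ≤ G) [IsPreprimitive G Ω] [Nontrivial Ω] {x : Ω}
    (h : ¬ IsPretransitive ((stabilizer G x).map G.subtype) (Fin n)) :
    ∃ k ≤ n, IsKSetAction G Ω k := by
  classical
  set K := (stabilizer G x).map G.subtype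
  obtain ⟨a, b, hab⟩ : ∃ a b : Fin n, ∀ g : K, g • a ≠ b := by
    by_contra! hcon
    exact h ⟨hcon⟩
  let D : Set.powersetCard (Fin n) (orbit K a).toFinset.card := ⟨(orbit K a).toFinset, rfl⟩
  have hle : stabilizer G x ≤ stabilizer G D := by
    intro g hg
    have horbit : (⟨g, g, hg, rfl⟩ : K) • orbit K a = orbit K a := smul_orbit _ a
    refine mem_stabilizer_iff.2 (Subtype.ext (Finset.coe_injective ?_))
    change ((g • (orbit K a).toFinset : Finset (Fin n)) : Set (Fin n)) = (orbit K a).toFinset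
    rw [Finset.coe_smul_finset, Set.coe_toFinset]
    exact horbit
  have hne : stabilizer G D ≠ ⊤ := by
    intro htop
    have := alternatingGroup.isPretransitive_of_three_le_card (Fin n) (by rwa [Nat.card_fin])
    obtain ⟨g, rfl⟩ := exists_smul_eq (alternatingGroup (Fin n)) a b
    have hD : (⟨g, hG g.2⟩ : G) • D = D :=
      mem_stabilizer_iff.1 (htop ▸ Subgroup.mem_top (⟨g, hG g.2⟩ : G))
    have hmem : (⟨g, hG g.2⟩ : G) • a ∈ (orbit K a).toFinset :=
      (congrArg Subtype.val hD).le
        (Finset.smul_mem_smul_finset (Set.mem_toFinset.2 (mem_orbit_self a)))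
    obtain ⟨k, hk⟩ := Set.mem_toFinset.1 hmem
    exact hab k hk
  have hcoatom : IsCoatom (stabilizer G x) :=
    (isCoatom_stabilizer_iff_preprimitive G x).2 inferInstance
  exact ⟨_, (Finset.card_le_univ _).trans_eq (Fintype.card_fin n),
    isKSetAction_of_stabilizer_eq hn hG ((hcoatom.le_iff.1 hle).resolve_left hne)⟩

theorem index_le_two_of_alternatingGroup_le {α : Type*} [Fintype α] [DecidableEq α]
    {K : Subgroup (Perm α)} (hK : alternatingGroup α ≤ K) : K.index ≤ 2 := by
  have hdvd := Subgroup.index_dvd_of_le hK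
  cases subsingleton_or_nontrivial α
  · rw [alternatingGroup.index_eq_one] at hdvd
    exact (Nat.le_of_dvd one_pos hdvd).trans one_le_two
  · rw [alternatingGroup.index_eq_two] at hdvd
    exact Nat.le_of_dvd two_pos hdvd

theorem not_alternatingGroup_le_map_stabilizer [IsPretransitive G Ω] (hcard : 3 ≤ Nat.card Ω)
    (x : Ω) : ¬ alternatingGroup (Fin n) ≤ (stabilizer G x).map G.subtype := by
  intro hle
  have hindex := index_le_two_of_alternatingGroup_le hle
  rw [Subgroup.index_map_subtype, index_stabilizer_of_transitive] at hindex
  have hpos : 0 < G.index := Nat.pos_of_ne_zero G.index_ne_zero_of_finite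
  exact absurd (hcard.trans ((Nat.le_mul_of_pos_right _ hpos).trans hindex)) (by norm_num)

theorem exists_isKSetAction_or_exists_forall_fixed (hn : 3 ≤ n)
    (hG : alternatingGroup (Fin n) ≤ G) [IsPreprimitive G Ω] (hcard : 3 ≤ Nat.card Ω) {k₀ : ℕ}
    (hk₀ : 2 * k₀ ≤ n) :
    (∃ k ≤ k₀, IsKSetAction G Ω k) ∨ ∃ a, k₀ ≤ a ∧ 2 * a ≤ n ∧ ∀ w : G, (∃ x : Ω, w • x = x) →
      ¬ HasPrimeCyclePower k₀ (n / 2) (w : Perm (Fin n)) ∨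
        HasInvariantSet a (w : Perm (Fin n)) := by
  have : Finite Ω := Nat.finite_of_card_ne_zero (by omega)
  have : Nontrivial Ω := Finite.one_lt_card_iff_nontrivial.1 (by omega)
  obtain ⟨x⟩ : Nonempty Ω := inferInstance
  by_cases htrans : IsPretransitive ((stabilizer G x).map G.subtype) (Fin n)
  · obtain ⟨a, ha, hinv⟩ := exists_forall_hasPrimeCyclePower_imp_hasInvariantSet
      (not_alternatingGroup_le_map_stabilizer (G := G) hcard x)
    rw [Fintype.card_fin] at ha hinv
    have hfix (w : G) (hw : ∃ y : Ω, w • y = y) (hY : HasPrimeCyclePower k₀ (n / 2) w.1) :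
        k₀ ≤ a ∧ HasInvariantSet a w.1 := by
      obtain ⟨y, hy⟩ := hw
      obtain ⟨g, rfl⟩ := exists_smul_eq G x y
      have hmem : (g : Perm (Fin n))⁻¹ * w * (g : Perm (Fin n))⁻¹⁻¹ ∈
          (stabilizer G x).map G.subtype := by
        refine ⟨g⁻¹ * w * g, ?_, by simp⟩
        rw [SetLike.mem_coe, mem_stabilizer_iff, mul_smul, mul_smul, hy, inv_smul_smul]
      have ⟨hka, hset⟩ := hinv _ hmem k₀ (hY.conj _)
      refine ⟨hka, ?_⟩
      simpa only [mul_assoc, mul_inv_cancel_left, inv_inv, mul_inv_cancel, mul_one] using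
        hset.conj (g : Perm (Fin n))
    rcases le_or_gt k₀ a with hka | hak
    · exact Or.inr ⟨a, hka, ha, fun w hw => or_iff_not_imp_left.2 fun h =>
        (hfix w hw (not_not.1 h)).2⟩
    · exact Or.inr ⟨k₀, le_rfl, hk₀, fun w hw => Or.inl fun h =>
        hak.not_ge (hfix w hw h).1⟩
  · obtain ⟨k, hkn, hk⟩ := exists_isKSetAction_of_not_isPretransitive hn hG htrans
    obtain ⟨l, hl, hln⟩ : ∃ l, IsKSetAction G Ω l ∧ 2 * l ≤ n := by
      rcases le_total (2 * k) n with hk2 | hk2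
      · exact ⟨k, hk, hk2⟩
      · exact ⟨n - k, hk.compl (Nat.sub_add_cancel hkn), by omega⟩
    rcases le_total l k₀ with hlk | hkl
    · exact Or.inl ⟨l, hlk, hl⟩
    · exact Or.inr ⟨l, hkl, hln, fun w ⟨y, hy⟩ => Or.inr (hl.hasInvariantSet hy)⟩

end PointStabilizers

section Dichotomy

theorem tendsto_reciprocalSum_Icc_one :
    Tendsto (fun k => reciprocalSum (Finset.Icc 1 k)) atTop atTop := by
  simp only [reciprocalSum_Icc_one_eq_harmonic]
  exact tendsto_atTop_mono log_add_one_le_harmonic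
    (Real.tendsto_log_atTop.comp (tendsto_natCast_atTop_atTop.comp (tendsto_add_atTop_nat 1)))

theorem eventually_forall_proportion_hasInvariantSet_le {ε : ℝ} (hε : 0 < ε) :
    ∀ᶠ k₀ : ℕ in atTop, ∀ k n : ℕ, k₀ ≤ k → 2 * k ≤ n →
      proportion (HasInvariantSet k (α := Fin n)) ≤ ε := by
  obtain ⟨k₁, hk₁⟩ := eventually_atTop.1
    (tendsto_reciprocalSum_Icc_one.eventually (eventually_ge_atTop (36 / ε)))
  filter_upwards [eventually_ge_atTop k₁, eventually_ge_atTop 1] with k₀ hk₀ hone k n hk hkn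
  have hpos := reciprocalSum_Icc_one_pos (hone.trans hk)
  calc proportion (HasInvariantSet k (α := Fin n)) ≤ 36 / reciprocalSum (Finset.Icc 1 k) :=
        proportion_hasInvariantSet_le (hone.trans hk) (by rwa [Fintype.card_fin])
    _ ≤ ε := (div_le_comm₀ hpos hε).2 (hk₁ k (hk₀.trans hk))

theorem one_sub_derangementProportion (G Ω : Type*) [Group G] [Finite G] [MulAction G Ω] :
    1 - derangementProportion G Ω = proportion fun w : G => ∃ x : Ω, w • x = x := by
  have := Fintype.ofFinite G
  have h : derangementProportion G Ω = 1 - proportion fun w : G => ∃ x : Ω, w • x = x := by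
    rw [← proportion_not]
    simp only [not_exists]
    rfl
  rw [h, sub_sub_cancel]

theorem exists_isKSetAction_or_one_sub_derangementProportion_le {ε : ℝ} (hε : 0 < ε) :
    ∃ k₀ : ℕ, ∀ᶠ n : ℕ in atTop, ∀ (G : Subgroup (Perm (Fin n))) (Ω : Type*) [MulAction G Ω],
      alternatingGroup (Fin n) ≤ G → IsPreprimitive G Ω → 3 ≤ Nat.card Ω →
      (∃ k ≤ k₀, IsKSetAction G Ω k) ∨ 1 - derangementProportion G Ω ≤ ε := by
  have hε4 : 0 < ε / 4 := by positivity
  obtain ⟨k₀, hinvariant⟩ := (eventually_forall_proportion_hasInvariantSet_le hε4).exists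
  refine ⟨k₀, ?_⟩
  filter_upwards [eventually_proportion_not_hasPrimeCyclePower_le hε4 k₀, eventually_ge_atTop 3,
    eventually_ge_atTop (2 * k₀)] with n hprime hn hk₀ G Ω _ hG _ hcard
  refine (exists_isKSetAction_or_exists_forall_fixed hn hG hcard hk₀).imp_right ?_
  rintro ⟨a, hka, han, hfix⟩
  have := Fintype.ofFinite G
  have hindex : (G.index : ℝ) ≤ 2 := by exact_mod_cast index_le_two_of_alternatingGroup_le hG
  let Q : Perm (Fin n) → Prop := fun σ => ¬ HasPrimeCyclePower k₀ (n / 2) σ ∨ HasInvariantSet a σ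
  calc 1 - derangementProportion G Ω
      = proportion fun w : G => ∃ x : Ω, w • x = x := one_sub_derangementProportion G Ω
    _ ≤ proportion fun w : G => Q w := proportion_mono hfix
    _ ≤ G.index * proportion Q := proportion_subgroup_le_index_mul G Q
    _ ≤ 2 * (ε / 4 + ε / 4) := by
        gcongr
        · exact proportion_nonneg Q
        · exact (proportion_le_add fun _ => id).trans
            (add_le_add hprime (hinvariant a n hka han))
    _ = ε := by ring

end Dichotomy

section Moments

variable (G Ω Ω' ι : Type*) [Group G] [MulAction G Ω] [MulAction G Ω']

theorem derangementProportion_eq_fixedPointLaw_zero [Finite Ω] :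
    derangementProportion G Ω = fixedPointLaw G Ω 0 := by
  have h (w : G) : (∀ x : Ω, w • x ≠ x) ↔ Nat.card (fixedBy Ω w) = 0 := by
    rw [Finite.card_eq_zero_iff, isEmpty_subtype]
    rfl
  simp only [derangementProportion, fixedPointLaw, h]

section FixedBy

variable {G}

theorem card_fixedBy_prod (w : G) :
    Nat.card (fixedBy (Ω × Ω') w) = Nat.card (fixedBy Ω w) * Nat.card (fixedBy Ω' w) := by
  have h : fixedBy (Ω × Ω') w = fixedBy Ω w ×ˢ fixedBy Ω' w := Set.ext fun _ => Prod.ext_iff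
  rw [h, Nat.card_congr (Equiv.Set.prod _ _), Nat.card_prod]

theorem card_fixedBy_pi [Fintype ι] (w : G) :
    Nat.card (fixedBy (ι → Ω) w) = Nat.card (fixedBy Ω w) ^ Fintype.card ι := by
  have h : fixedBy (ι → Ω) w = {f | ∀ j, f j ∈ fixedBy Ω w} := Set.ext fun _ => funext_iff
  rw [h, ← Nat.card_eq_fintype_card, ← Nat.card_fun]
  exact Nat.card_congr Equiv.subtypePiEquivPi

end FixedBy

section Fintype

variable [Fintype G]

theorem sum_mul_fixedPointLaw (f : ℕ → ℝ) (s : Finset ℕ) :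
    ∑ j ∈ s, f j * fixedPointLaw G Ω j =
      𝔼 w : G, if Nat.card (fixedBy Ω w) ∈ s then f (Nat.card (fixedBy Ω w)) else 0 := by
  classical
  have hlaw (j : ℕ) : fixedPointLaw G Ω j =
      𝔼 w : G, if Nat.card (fixedBy Ω w) = j then (1 : ℝ) else 0 := proportion_eq_expect _
  simp only [hlaw, Finset.mul_expect, ← Finset.expect_sum_comm, mul_ite, mul_one, mul_zero,
    Finset.sum_ite_eq]

variable [Finite Ω]

theorem expect_card_fixedBy :
    𝔼 w : G, (Nat.card (fixedBy Ω w) : ℝ) = Nat.card (orbitRel.Quotient G Ω) := by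
  classical
  have := Fintype.ofFinite Ω
  have : Fintype (Quotient (orbitRel G Ω)) := Fintype.ofFinite _
  have burnside := sum_card_fixedBy_eq_card_orbits_mul_card_group G Ω
  have hG : (Fintype.card G : ℝ) ≠ 0 := Nat.cast_ne_zero.2 Fintype.card_ne_zero
  rw [Fintype.expect_eq_sum_div_card, div_eq_iff hG]
  simp only [← Nat.card_eq_fintype_card] at burnside ⊢
  exact_mod_cast burnside

theorem expect_card_fixedBy_of_isPretransitive [IsPretransitive G Ω] [Nonempty Ω] :
    𝔼 w : G, (Nat.card (fixedBy Ω w) : ℝ) = 1 := by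
  obtain ⟨_⟩ := (pretransitive_iff_unique_quotient_of_nonempty G Ω).1 inferInstance
  rw [expect_card_fixedBy, Nat.card_unique, Nat.cast_one]

theorem expect_card_fixedBy_sq :
    𝔼 w : G, (Nat.card (fixedBy Ω w) : ℝ) ^ 2 = actionRank G Ω := by
  rw [actionRank, ← expect_card_fixedBy]
  exact Finset.expect_congr rfl fun w _ => by rw [card_fixedBy_prod, Nat.cast_mul, sq]

theorem expect_card_fixedBy_pow [Fintype ι] :
    𝔼 w : G, (Nat.card (fixedBy Ω w) : ℝ) ^ Fintype.card ι =
      Nat.card (orbitRel.Quotient G (ι → Ω)) := by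
  rw [← expect_card_fixedBy]
  exact Finset.expect_congr rfl fun w _ => by rw [card_fixedBy_pi, Nat.cast_pow]

end Fintype

variable [Finite G] [Finite Ω]

theorem one_le_mul_actionRank [IsPretransitive G Ω] [Nonempty Ω] :
    1 ≤ (1 - derangementProportion G Ω) * actionRank G Ω := by
  classical
  have := Fintype.ofFinite G
  let fixes : G → ℝ := fun w => if ∃ x : Ω, w • x = x then 1 else 0
  let F : G → ℝ := fun w => Nat.card (fixedBy Ω w)
  have hfixes (w : G) : fixes w * F w = F w := by
    by_cases hw : ∃ x : Ω, w • x = x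
    · simp only [fixes, if_pos hw, one_mul]
    · have : IsEmpty (fixedBy Ω w) := ⟨fun x => hw ⟨x.1, x.2⟩⟩
      simp only [F, Nat.card_of_isEmpty, Nat.cast_zero, mul_zero]
  have hsq (w : G) : fixes w ^ 2 = fixes w := by
    simp only [fixes, ite_pow, one_pow, zero_pow two_ne_zero]
  calc (1 : ℝ) = (𝔼 w, fixes w * F w) ^ 2 := by
        simp only [hfixes, F, expect_card_fixedBy_of_isPretransitive, one_pow]
    _ ≤ (𝔼 w, fixes w ^ 2) * 𝔼 w, F w ^ 2 := Finset.expect_mul_sq_le_sq_mul_sq _ _ _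
    _ = (1 - derangementProportion G Ω) * actionRank G Ω := by
        simp only [hsq, F, expect_card_fixedBy_sq, one_sub_derangementProportion,
          proportion_eq_expect, fixes]

theorem abs_sum_sq_mul_fixedPointLaw_sub_le {J : ℕ} (hJ : 0 < J) :
    |∑ j ∈ Finset.range J, (j : ℝ) ^ 2 * fixedPointLaw G Ω j - actionRank G Ω| ≤
      Nat.card (orbitRel.Quotient G (Fin 3 → Ω)) / J := by
  have := Fintype.ofFinite G
  let F : G → ℝ := fun w => Nat.card (fixedBy Ω w)
  let tail : G → ℝ := fun w => if Nat.card (fixedBy Ω w) < J then 0 else F w ^ 2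
  have htail : actionRank G Ω - ∑ j ∈ Finset.range J, (j : ℝ) ^ 2 * fixedPointLaw G Ω j =
      𝔼 w, tail w := by
    rw [← expect_card_fixedBy_sq, sum_mul_fixedPointLaw, ← Finset.expect_sub_distrib]
    refine Finset.expect_congr rfl fun w _ => ?_
    simp only [tail, F, Finset.mem_range]
    split_ifs <;> ring
  have htail_nonneg (w : G) : 0 ≤ tail w := by
    simp only [tail]
    split_ifs <;> positivity
  have htail_le (w : G) : tail w ≤ F w ^ 3 / J := by
    simp only [tail]
    split_ifs with hw
    · positivity
    · have hJw : (J : ℝ) ≤ F w := Nat.cast_le.2 (not_lt.1 hw)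
      rw [le_div_iff₀ (Nat.cast_pos.2 hJ), pow_succ _ 2]
      gcongr
  rw [abs_sub_comm, htail, abs_of_nonneg (Finset.expect_nonneg fun w _ => htail_nonneg w)]
  calc 𝔼 w, tail w ≤ 𝔼 w, F w ^ 3 / J := Finset.expect_le_expect fun w _ => htail_le w
    _ = Nat.card (orbitRel.Quotient G (Fin 3 → Ω)) / J := by
        rw [← Finset.expect_div, ← expect_card_fixedBy_pow, Fintype.card_fin]

end Moments

section LimitsOfActions

variable {κ : Type*} {l : Filter κ} {G Ω : κ → Type*} [∀ i, Group (G i)] [∀ i, Finite (G i)]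
  [∀ i, MulAction (G i) (Ω i)] [∀ i, Finite (Ω i)]

theorem tendsto_actionRank_of_tendsto_derangementProportion [∀ i, IsPretransitive (G i) (Ω i)]
    [∀ i, Nonempty (Ω i)] (h : Tendsto (fun i => derangementProportion (G i) (Ω i)) l (𝓝 1)) :
    Tendsto (fun i => actionRank (G i) (Ω i)) l atTop := by
  have hmoment (i : κ) := one_le_mul_actionRank (G i) (Ω i)
  have hpos (i : κ) : 0 < 1 - derangementProportion (G i) (Ω i) :=
    pos_of_mul_pos_left (one_pos.trans_le (hmoment i)) (Nat.cast_nonneg _)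
  have hzero : Tendsto (fun i => 1 - derangementProportion (G i) (Ω i)) l (𝓝[>] 0) :=
    tendsto_nhdsWithin_iff.2 ⟨by simpa using h.const_sub 1, .of_forall hpos⟩
  rw [← tendsto_natCast_atTop_iff (R := ℝ)]
  exact tendsto_atTop_mono (fun i => (inv_le_iff_one_le_mul₀' (hpos i)).2 (hmoment i))
    (tendsto_inv_nhdsGT_zero.comp hzero)

/-- A bound on the third moments makes the squares of the fixed point numbers uniformly
integrable, so the second moments, which are the integers `actionRank`, converge. -/
theorem exists_eventually_actionRank_eq {M : ℕ}
    (hM : ∀ᶠ i in l, Nat.card (orbitRel.Quotient (G i) (Fin 3 → Ω i)) ≤ M) {p : ℕ → ℝ}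
    (hp : ∀ j, Tendsto (fun i => fixedPointLaw (G i) (Ω i) j) l (𝓝 (p j))) :
    ∃ r, ∀ᶠ i in l, actionRank (G i) (Ω i) = r := by
  set J := 4 * (M + 1)
  have hmoment : Tendsto (fun i => ∑ j ∈ Finset.range J,
      (j : ℝ) ^ 2 * fixedPointLaw (G i) (Ω i) j) l (𝓝 (∑ j ∈ Finset.range J, (j : ℝ) ^ 2 * p j)) :=
    tendsto_finsetSum _ fun j _ => (hp j).const_mul _
  set s := ∑ j ∈ Finset.range J, (j : ℝ) ^ 2 * p j
  refine ⟨(round s).toNat, ?_⟩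
  filter_upwards [hM, Metric.tendsto_nhds.1 hmoment (1 / 4) (by norm_num)] with i hi hs
  have htrunc : |∑ j ∈ Finset.range J, (j : ℝ) ^ 2 * fixedPointLaw (G i) (Ω i) j -
      actionRank (G i) (Ω i)| ≤ 1 / 4 := by
    refine (abs_sum_sq_mul_fixedPointLaw_sub_le (G i) (Ω i) (by positivity)).trans ?_
    rw [div_le_div_iff₀ (by positivity) (by norm_num)]
    exact_mod_cast (by omega : _ * 4 ≤ 1 * J)
  have hround : |((actionRank (G i) (Ω i) - round s : ℤ) : ℝ)| < 1 := by
    have := abs_lt.1 (Real.dist_eq _ s ▸ hs)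
    have := abs_le.1 htrunc
    have := abs_le.1 (abs_sub_round s)
    push_cast
    exact abs_lt.2 ⟨by linarith, by linarith⟩
  rw [← Int.cast_abs, ← Int.cast_one, Int.cast_lt, Int.abs_lt_one_iff] at hround
  omega

end LimitsOfActions

section VennCells

open scoped Pointwise

variable {α ι : Type*} [Fintype α] [DecidableEq α]

/-- There are fewer colours than points, so two points share a colour, and composing with their
transposition corrects the sign. -/
theorem exists_mem_alternatingGroup_forall_apply_eq {T : Type*} [Fintype T] [DecidableEq T]
    (hT : Fintype.card T < Fintype.card α) {c c' : α → T}
    (h : ∀ t, (Finset.univ.filter fun i => c i = t).card =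
      (Finset.univ.filter fun i => c' i = t).card) :
    ∃ g ∈ alternatingGroup α, ∀ i, c' (g i) = c i := by
  have e (t : T) : {i // c i = t} ≃ {i // c' i = t} := Fintype.equivOfCardEq <| by
    rw [Fintype.card_subtype, Fintype.card_subtype, h t]
  let σ : Perm α := Equiv.ofFiberEquiv e
  have hσ (i : α) : c' (σ i) = c i := Equiv.ofFiberEquiv_map e i
  rcases Int.units_eq_one_or (Perm.sign σ) with hs | hs
  · exact ⟨σ, Perm.mem_alternatingGroup.2 hs, hσ⟩
  · obtain ⟨i, j, hij, hc⟩ := Fintype.exists_ne_map_eq_of_card_lt c hT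
    refine ⟨σ * swap i j, ?_, fun l => (hσ _).trans (Equiv.apply_swap_eq_self hc l)⟩
    rw [Perm.mem_alternatingGroup, Perm.sign_mul, hs, Perm.sign_swap hij, neg_one_mul, neg_neg]

theorem exists_card_inter_eq {k m : ℕ} (hk : 2 * k ≤ Fintype.card α) (hm : m ≤ k) :
    ∃ A B : Finset α, A.card = k ∧ B.card = k ∧ (A ∩ B).card = m := by
  obtain ⟨M, -, hM⟩ := Finset.exists_subset_card_eq (s := (Finset.univ : Finset α)) (n := m)
    (by rw [Finset.card_univ]; omega)
  obtain ⟨A, hMA, hA⟩ := Finset.exists_superset_card_eq (s := M) (n := k) (by omega) (by omega)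
  have hdisj : Disjoint M Aᶜ := disjoint_compl_right_iff.2 hMA
  obtain ⟨B, hMB, hB, hBk⟩ := Finset.exists_subsuperset_card_eq (n := k)
    (Finset.subset_union_left : M ⊆ M ∪ Aᶜ) (by omega)
    (by rw [Finset.card_union_of_disjoint hdisj, Finset.card_compl]; omega)
  have hAB : A ∩ B = M := (Finset.subset_inter hMA hMB).antisymm' fun i hi =>
    (Finset.mem_union.1 (hB (Finset.mem_inter.1 hi).2)).resolve_right fun h =>
      Finset.mem_compl.1 h (Finset.mem_inter.1 hi).1
  exact ⟨A, B, hA, hBk, hAB ▸ hM⟩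

variable [Fintype ι] [DecidableEq ι]

/-- The cell of the Venn diagram of the family `A` that is contained in `A j` for the indices
`j ∈ t` and disjoint from `A j` for the others. -/
def vennCell (A : ι → Finset α) (t : Finset ι) : Finset α :=
  Finset.univ.filter fun i => ∀ j, j ∈ t ↔ i ∈ A j

theorem filter_filter_mem_eq (A : ι → Finset α) (t : Finset ι) :
    (Finset.univ.filter fun i => (Finset.univ.filter fun j => i ∈ A j) = t) = vennCell A t :=
  Finset.filter_congr fun i _ => by simp [Finset.ext_iff, iff_comm]

theorem card_vennCell_le (A : ι → Finset α) {t : Finset ι} {j : ι} (hj : j ∈ t) :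
    (vennCell A t).card ≤ (A j).card :=
  Finset.card_le_card fun _ hi => ((Finset.mem_filter.1 hi).2 j).1 hj

theorem sum_card_vennCell (A : ι → Finset α) : ∑ t, (vennCell A t).card = Fintype.card α := by
  simp only [← filter_filter_mem_eq]
  exact (Finset.card_eq_sum_card_fiberwise fun _ _ => Finset.mem_coe.2 (Finset.mem_univ _)).symm

theorem card_vennCell_eq_of_forall_nonempty {A B : ι → Finset α}
    (h : ∀ t : Finset ι, t.Nonempty → (vennCell A t).card = (vennCell B t).card) (t : Finset ι) :
    (vennCell A t).card = (vennCell B t).card := by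
  rcases t.eq_empty_or_nonempty with rfl | ht
  · have hsum := (sum_card_vennCell A).trans (sum_card_vennCell B).symm
    rw [← Finset.add_sum_erase _ _ (Finset.mem_univ ∅),
      ← Finset.add_sum_erase _ (fun t => (vennCell B t).card) (Finset.mem_univ ∅),
      Finset.sum_congr rfl fun t ht =>
        h t (Finset.nonempty_iff_ne_empty.2 (Finset.ne_of_mem_erase ht))] at hsum
    exact Nat.add_right_cancel hsum
  · exact h t ht

theorem exists_mem_alternatingGroup_forall_smul_eq (hι : 2 ^ Fintype.card ι < Fintype.card α)
    {A B : ι → Finset α}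
    (h : ∀ t : Finset ι, t.Nonempty → (vennCell A t).card = (vennCell B t).card) :
    ∃ g ∈ alternatingGroup α, ∀ j, g • A j = B j := by
  obtain ⟨g, hg, hgc⟩ := exists_mem_alternatingGroup_forall_apply_eq
    (c := fun i => Finset.univ.filter fun j => i ∈ A j)
    (c' := fun i => Finset.univ.filter fun j => i ∈ B j) (by rwa [Fintype.card_finset]) fun t => by
      rw [filter_filter_mem_eq, filter_filter_mem_eq, card_vennCell_eq_of_forall_nonempty h]
  have hmem (i : α) (j : ι) : g i ∈ B j ↔ i ∈ A j := by
    simpa using Finset.ext_iff.1 (hgc i) j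
  refine ⟨g, hg, fun j => Finset.ext fun i => ?_⟩
  rw [← Finset.inv_smul_mem_iff, ← hmem, ← Perm.smul_def, smul_inv_smul]

theorem card_vennCell_pair (A B : Finset α) {t : Finset (Fin 2)} (ht : t.Nonempty) :
    (vennCell ![A, B] t).card = if 0 ∈ t then if 1 ∈ t then (A ∩ B).card
      else A.card - (A ∩ B).card else B.card - (A ∩ B).card := by
  split_ifs with h0 h1
  · congr 1
    ext i
    simp [vennCell, Fin.forall_fin_two, h0, h1]
  · rw [← Finset.card_sdiff_of_subset Finset.inter_subset_left, Finset.sdiff_inter_self_left]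
    congr 1
    ext i
    simp [vennCell, Fin.forall_fin_two, h0, h1]
  · have h1 : 1 ∈ t := by
      obtain ⟨j, hj⟩ := ht
      fin_cases j
      exacts [absurd hj h0, hj]
    rw [← Finset.card_sdiff_of_subset Finset.inter_subset_right, Finset.sdiff_inter_self_right]
    congr 1
    ext i
    simp [vennCell, Fin.forall_fin_two, h0, h1, and_comm]

theorem exists_mem_alternatingGroup_smul_eq_and_smul_eq (hα : 4 < Fintype.card α)
    {A B A' B' : Finset α} (hA : A.card = A'.card) (hB : B.card = B'.card)
    (hAB : (A ∩ B).card = (A' ∩ B').card) :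
    ∃ g ∈ alternatingGroup α, g • A = A' ∧ g • B = B' := by
  obtain ⟨g, hg, hgA⟩ := exists_mem_alternatingGroup_forall_smul_eq
    (A := ![A, B]) (B := ![A', B']) (by rwa [Fintype.card_fin]) fun t ht => by
      rw [card_vennCell_pair _ _ ht, card_vennCell_pair _ _ ht, hA, hB, hAB]
  exact ⟨g, hg, hgA 0, hgA 1⟩

end VennCells

section KSets

open scoped Pointwise

variable {n k : ℕ} {G : Subgroup (Perm (Fin n))} {Ω : Type*} [MulAction G Ω]

theorem smul_eq_of_smul_coe_eq {e : Ω →[G] Set.powersetCard (Fin n) k} (he : Injective e) {g : G}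
    {x y : Ω} (h : (g : Perm (Fin n)) • (e x : Finset (Fin n)) = e y) : g • x = y :=
  he ((map_smul e g x).trans (Subtype.ext h))

theorem exists_smul_eq_iff_card_inter_eq (hG : alternatingGroup (Fin n) ≤ G) (hn : 4 < n)
    {e : Ω →[G] Set.powersetCard (Fin n) k} (he : Injective e) (z z' : Ω × Ω) :
    (∃ g : G, g • z = z') ↔ ((e z.1 : Finset (Fin n)) ∩ e z.2).card =
      ((e z'.1 : Finset (Fin n)) ∩ e z'.2).card := by
  constructor
  · rintro ⟨g, rfl⟩
    have hsmul (x : Ω) : (e (g • x) : Finset (Fin n)) = g • (e x : Finset (Fin n)) :=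
      congrArg Subtype.val (map_smul e g x)
    rw [Prod.smul_fst, Prod.smul_snd, hsmul, hsmul, ← Finset.smul_finset_inter,
      Finset.card_smul_finset]
  · intro h
    obtain ⟨g, hg, h1, h2⟩ := exists_mem_alternatingGroup_smul_eq_and_smul_eq
      (by rwa [Fintype.card_fin]) ((e z.1).2.trans (e z'.1).2.symm)
      ((e z.2).2.trans (e z'.2).2.symm) h
    exact ⟨⟨g, hG hg⟩, Prod.ext (smul_eq_of_smul_coe_eq he h1) (smul_eq_of_smul_coe_eq he h2)⟩

theorem IsKSetAction.actionRank_eq (hG : alternatingGroup (Fin n) ≤ G) (hn : 4 < n)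
    (hk : 2 * k ≤ n) (h : IsKSetAction G Ω k) : actionRank G Ω = k + 1 := by
  obtain ⟨e, he⟩ := h
  let f : Ω × Ω → Fin (k + 1) := fun z => ⟨((e z.1 : Finset (Fin n)) ∩ e z.2).card,
    Nat.lt_succ_of_le ((Finset.card_le_card Finset.inter_subset_left).trans_eq (e z.1).2)⟩
  have hker : orbitRel G (Ω × Ω) = Setoid.ker f := Setoid.ext fun z z' => by
    rw [orbitRel_apply, Setoid.ker_def, eq_comm, Fin.ext_iff,
      ← exists_smul_eq_iff_card_inter_eq hG hn he.injective]
    rfl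
  have hsurj : Surjective f := fun m => by
    obtain ⟨A, B, hA, hB, hAB⟩ := exists_card_inter_eq (α := Fin n) (k := k) (m := m)
      (by rwa [Fintype.card_fin]) (Nat.le_of_lt_succ m.2)
    obtain ⟨x, hx⟩ := he.surjective ⟨A, hA⟩
    obtain ⟨y, hy⟩ := he.surjective ⟨B, hB⟩
    exact ⟨(x, y), Fin.ext (by simpa only [f, hx, hy] using hAB)⟩
  rw [actionRank, orbitRel.Quotient, hker,
    Nat.card_congr (Setoid.quotientKerEquivOfSurjective f hsurj), Nat.card_fin]

theorem IsKSetAction.card_orbits_pi_le (hG : alternatingGroup (Fin n) ≤ G) (ι : Type*) [Fintype ι]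
    (hn : 2 ^ Fintype.card ι < n) (h : IsKSetAction G Ω k) :
    Nat.card (orbitRel.Quotient G (ι → Ω)) ≤ (k + 1) ^ 2 ^ Fintype.card ι := by
  classical
  obtain ⟨e, he⟩ := h
  let cell (z : ι → Ω) (t : Finset ι) : Finset (Fin n) := vennCell (fun j => (e (z j)).1) t
  have hcell (z : ι → Ω) {t : Finset ι} (ht : t.Nonempty) : (cell z t).card < k + 1 :=
    Nat.lt_succ_of_le ((card_vennCell_le _ ht.choose_spec).trans_eq (e (z _)).2)
  let q (s : orbitRel.Quotient G (ι → Ω)) (t : {t : Finset ι // t.Nonempty}) : Fin (k + 1) :=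
    ⟨(cell s.out t).card, hcell _ t.2⟩
  have hq : Injective q := fun s s' hss => by
    obtain ⟨g, hg, hgz⟩ := exists_mem_alternatingGroup_forall_smul_eq
      (A := fun j => (e (s'.out j)).1) (B := fun j => (e (s.out j)).1)
      (by rwa [Fintype.card_fin]) fun t ht => (Fin.ext_iff.1 (congrFun hss ⟨t, ht⟩)).symm
    rw [← Quotient.out_eq s, ← Quotient.out_eq s']
    exact Quotient.sound (orbitRel_apply.2
      ⟨⟨g, hG hg⟩, funext fun j => smul_eq_of_smul_coe_eq he.injective (hgz j)⟩)
  calc Nat.card (orbitRel.Quotient G (ι → Ω))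
      ≤ Nat.card ({t : Finset ι // t.Nonempty} → Fin (k + 1)) := Nat.card_le_card_of_injective q hq
    _ = (k + 1) ^ Fintype.card {t : Finset ι // t.Nonempty} := by
        rw [Nat.card_fun, Nat.card_fin, Nat.card_eq_fintype_card]
    _ ≤ (k + 1) ^ 2 ^ Fintype.card ι := by
        rw [← Fintype.card_finset]
        exact Nat.pow_le_pow_right k.succ_pos (Fintype.card_subtype_le _)

end KSets

section LimitTheorem

theorem toReal_apply_lt_one_of_ne_pure {α : Type*} {p : PMF α} {a : α} (h : p ≠ PMF.pure a) :
    (p a).toReal < 1 := by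
  have hne : p a ≠ 1 := by
    intro ha
    have hsupp := (p.apply_eq_one_iff a).1 ha
    refine h (PMF.ext fun b => ?_)
    by_cases hb : b = a
    · rw [hb, ha, PMF.pure_apply_self]
    · rw [PMF.pure_apply_of_ne _ _ hb, p.apply_eq_zero_iff, hsupp]
      exact hb
  rw [← ENNReal.toReal_one]
  exact (ENNReal.toReal_lt_toReal (p.apply_ne_top a) ENNReal.one_ne_top).2
    ((p.coe_le_one a).lt_of_ne hne)

variable {κ : Type*} {l : Filter κ} {n : κ → ℕ} {G : ∀ i, Subgroup (Perm (Fin (n i)))}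
  {Ω : κ → Type*} [∀ i, MulAction (G i) (Ω i)]

theorem eventually_not_isKSetAction_of_tendsto_actionRank (hn : Tendsto n l atTop)
    (hG : ∀ i, alternatingGroup (Fin (n i)) ≤ G i)
    (h : Tendsto (fun i => actionRank (G i) (Ω i)) l atTop) (k : ℕ) :
    ∀ᶠ i in l, ¬ IsKSetAction (G i) (Ω i) k := by
  filter_upwards [h.eventually (eventually_gt_atTop (k + 1)), hn.eventually (eventually_gt_atTop 4),
    hn.eventually (eventually_ge_atTop (2 * k))] with i hrank hn4 hnk hset
  exact hrank.ne' (hset.actionRank_eq (hG i) hn4 hnk)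

theorem exists_eventually_isKSetAction_or_one_sub_derangementProportion_le
    (hn : Tendsto n l atTop) (hG : ∀ i, alternatingGroup (Fin (n i)) ≤ G i)
    (hprim : ∀ i, IsPreprimitive (G i) (Ω i)) (hcard : ∀ i, 3 ≤ Nat.card (Ω i)) {ε : ℝ}
    (hε : 0 < ε) :
    ∃ k₀ : ℕ, ∀ᶠ i in l, (∃ k ≤ k₀, IsKSetAction (G i) (Ω i) k) ∨
      1 - derangementProportion (G i) (Ω i) ≤ ε := by
  obtain ⟨k₀, hk₀⟩ := exists_isKSetAction_or_one_sub_derangementProportion_le hε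
  exact ⟨k₀, (hn.eventually hk₀).mono fun i hi => hi (G i) (Ω i) (hG i) (hprim i) (hcard i)⟩

theorem tendsto_derangementProportion_of_eventually_not_isKSetAction (hn : Tendsto n l atTop)
    (hG : ∀ i, alternatingGroup (Fin (n i)) ≤ G i)
    (hprim : ∀ i, IsPreprimitive (G i) (Ω i)) (hcard : ∀ i, 3 ≤ Nat.card (Ω i))
    (h : ∀ k, ∀ᶠ i in l, ¬ IsKSetAction (G i) (Ω i) k) :
    Tendsto (fun i => derangementProportion (G i) (Ω i)) l (𝓝 1) := by
  have hle (i : κ) : derangementProportion (G i) (Ω i) ≤ 1 := by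
    rw [← sub_nonneg, one_sub_derangementProportion]
    exact proportion_nonneg _
  refine tendsto_order.2 ⟨fun b hb => ?_, fun b hb => .of_forall fun i => (hle i).trans_lt hb⟩
  obtain ⟨k₀, hk₀⟩ := exists_eventually_isKSetAction_or_one_sub_derangementProportion_le
    hn hG hprim hcard (half_pos (sub_pos.2 hb))
  filter_upwards [hk₀, (eventually_all_finite (Set.finite_Iic k₀)).2 fun k _ => h k]
    with i hi hnot
  have := hi.resolve_left fun ⟨k, hk, hset⟩ => hnot k hk hset
  linarith

theorem exists_eventually_isKSetAction_of_tendsto_fixedPointLaw [∀ i, Finite (Ω i)]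
    (hn : Tendsto n l atTop) (hG : ∀ i, alternatingGroup (Fin (n i)) ≤ G i)
    (hprim : ∀ i, IsPreprimitive (G i) (Ω i)) (hcard : ∀ i, 3 ≤ Nat.card (Ω i)) {p : ℕ → ℝ}
    (hp0 : p 0 < 1) (hp : ∀ j, Tendsto (fun i => fixedPointLaw (G i) (Ω i) j) l (𝓝 (p j))) :
    ∃ k : ℕ, ∀ᶠ i in l, IsKSetAction (G i) (Ω i) k := by
  obtain ⟨k₀, hk₀⟩ := exists_eventually_isKSetAction_or_one_sub_derangementProportion_le
    hn hG hprim hcard (half_pos (sub_pos.2 hp0))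
  have hset : ∀ᶠ i in l, ∃ k ≤ k₀, IsKSetAction (G i) (Ω i) k := by
    have hlim := hp 0
    simp only [← derangementProportion_eq_fixedPointLaw_zero] at hlim
    filter_upwards [hk₀, hlim.eventually_lt_const (by linarith : p 0 < (1 + p 0) / 2)] with i hi hlt
    exact hi.resolve_right (by linarith)
  have horbits : ∀ᶠ i in l,
      Nat.card (orbitRel.Quotient (G i) (Fin 3 → Ω i)) ≤ (k₀ + 1) ^ 8 := by
    filter_upwards [hset, hn.eventually (eventually_gt_atTop 8)] with i ⟨k, hk, hki⟩ hn8
    exact (hki.card_orbits_pi_le (hG i) (Fin 3) hn8).trans (Nat.pow_le_pow_left (by omega) 8)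
  obtain ⟨r, hr⟩ := exists_eventually_actionRank_eq horbits hp
  refine ⟨r - 1, ?_⟩
  filter_upwards [hset, hr, hn.eventually (eventually_gt_atTop 4),
    hn.eventually (eventually_ge_atTop (2 * k₀))] with i ⟨k, hk, hki⟩ hri hn4 hnk
  have hrank := hki.actionRank_eq (hG i) hn4 (by omega)
  rwa [show r - 1 = k by omega]

end LimitTheorem

theorem theorem3p3 (n : ℕ → ℕ) (hn : Tendsto n atTop atTop)
    (G : (i : ℕ) → Subgroup (Equiv.Perm (Fin (n i))))
    (hG : ∀ i, G i = ⊤ ∨ G i = alternatingGroup (Fin (n i)))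
    (Ω : ℕ → Type*) [∀ i, Finite (Ω i)] [∀ i, MulAction (G i) (Ω i)]
    (hprim : ∀ i, MulAction.IsPreprimitive (G i) (Ω i))
    (hcard : ∀ i, 3 ≤ Nat.card (Ω i)) :
    List.TFAE [
      Tendsto (fun i => derangementProportion (G i) (Ω i)) atTop (𝓝 1),
      ¬ ∃ k : ℕ, ∃ᶠ i in atTop, IsKSetAction (G i) (Ω i) k,
      Tendsto (fun i => actionRank (G i) (Ω i)) atTop atTop] ∧
    ∀ p : PMF ℕ, p ≠ PMF.pure 0 →
      (∀ j, Tendsto (fun i => fixedPointLaw (G i) (Ω i) j) atTop (𝓝 (p j).toReal)) →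
      ∃ k : ℕ, ∀ᶠ i in atTop, IsKSetAction (G i) (Ω i) k := by
  have hA (i : ℕ) : alternatingGroup (Fin (n i)) ≤ G i := (hG i).elim (· ▸ le_top) (·.ge)
  have hne (i : ℕ) : Nonempty (Ω i) := (Nat.card_pos_iff.1 (three_pos.trans_le (hcard i))).1
  refine ⟨?_, fun p hp hlaw => exists_eventually_isKSetAction_of_tendsto_fixedPointLaw
    hn hA hprim hcard (toReal_apply_lt_one_of_ne_pure hp) hlaw⟩
  simp only [not_exists, not_frequently]
  tfae_have 1 → 3 := tendsto_actionRank_of_tendsto_derangementProportion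
  tfae_have 3 → 2 := eventually_not_isKSetAction_of_tendsto_actionRank hn hA
  tfae_have 2 → 1 := tendsto_derangementProportion_of_eventually_not_isKSetAction hn hA hprim hcard
  tfae_finish
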